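/- **Setting.** Let $d\ge 1$, $\mathfrak L=\mathbb Z^d$ with Euclidean length $|\cdot|$, and $\Lambda_L=\{x\in\mathfrak L:|x_1|,\dots,|x_d|\le L\}$ for $L\ge 0$. Let $\mathcal U$ be the CAR $C^*$-algebra of $\mathfrak L$, generated by a unit and elements $a_x$, $x\in\mathfrak L$, with $a_xa_y+a_ya_x=0$ and $a_xa_y^*+a_y^*a_x=\delta_{x,y}\mathbf 1$. For finite $\Lambda\subset\mathfrak L$ let $\mathcal U_\Lambda$ be the $*$-subalgebra generated by $\mathbf 1$ and $a_x$, $x\in\Lambda$. Let $\mathcal U^+$ be the set of even elements, that is, the fixed points of the $*$-automorphism with $a_x\mapsto -a_x$, and let $\chi_x$ be the $*$-automorphism with $\chi_x(a_y)=a_{y+x}$. Let $\mathbf F:[0,\infty)\to(0,\infty)$ be non-increasing with $\sum_{x\in\mathfrak L}\mathbf F(|x|)<\infty$ and $$\mathbf D=\sup_{x,y\in\mathfrak L}\sum_{z\in\mathfrak L}\frac{\mathbf F(|x-z|)\,\mathbf F(|z-y|)}{\mathbf F(|x-y|)}<\infty .$$ An interaction is a family $\Phi=\{\Phi_\Lambda\}$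 of self-adjoint elements $\Phi_\Lambda\in\mathcal U^+\cap\mathcal U_\Lambda$, indexed by the finite subsets of $\mathfrak L$, with $\Phi_\emptyset=0$; $\mathcal W$ is the space of interactions with $$\|\Phi\|_{\mathcal W}=\sup_{x,y\in\mathfrak L}\ \sum_{\Lambda\supset\{x,y\}}\frac{\|\Phi_\Lambda\|}{\mathbf F(|x-y|)}<\infty .$$ A potential is a family of self-adjoint elements $\mathbf V_{\{x\}}\in\mathcal U^+\cap\mathcal U_{\{x\}}$, $x\in\mathfrak L$ (not necessarily bounded in $x$). **Dynamics.** Let $\Psi=\{\Psi^{(t)}\}_{t\in\mathbb R}\subset\mathcal W$ with $\|\Psi\|_\infty=\sup_{t}\|\Psi^{(t)}\|_{\mathcal W}<\infty$, and let $\{\mathbf V^{(t)}\}_{t\in\mathbb R}$ be potentials. Assume that $t\mapsto\Psi^{(t)}_\Lambda$ and $t\mapsto\mathbf V^{(t)}_{\{y\}}$ are norm continuous for each finite $\Lambda\subset\mathfrak L$ and each $y\in\mathfrak L$. Put $$\delta^{(L)}_t(B)=i\sum_{\Lambda\subseteq\Lambda_L}[\Psi^{(t)}_\Lambda,B]+i\sum_{x\in\Lambda_L}[\mathbf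 V^{(t)}_{\{x\}},B],$$ and let $\tau^{(L)}_{t,s}$ be the solution of $\partial_t\tau^{(L)}_{t,s}=\tau^{(L)}_{t,s}\circ\delta_t^{(L)}$, $\partial_s\tau^{(L)}_{t,s}=-\delta_s^{(L)}\circ\tau^{(L)}_{t,s}$, $\tau^{(L)}_{s,s}=\mathbf 1$, in the bounded operators on $\mathcal U$. Let $\tau_{t,s}$ be the strong limit of $\tau^{(L)}_{t,s}$ as $L\to\infty$. **Notation for the bound.** Multi-commutators are $[B_1,B_0]^{(2)}=B_1B_0-B_0B_1$ and $[B_k,\dots,B_0]^{(k+1)}=[B_k,[B_{k-1},\dots,B_0]^{(k)}]$. Let $\mathcal T_2=\{\{\{0,1\}\}\}$ and $\mathcal T_{k+1}=\{\{\{j,k\}\}\cup T:0\le j\le k-1,\ T\in\mathcal T_k\}$ for $k\ge2$; for $T\in\mathcal T_{k+1}$ and $1\le j\le k$ let $P_T(j)$ be the unique $i<j$ with $\{i,j\}\in T$. For $n_0,\dots,n_k\in\mathbb N_0$ and $x_0,\dots,x_k\in\mathfrak L$ set $$\varkappa_T(\{(n_j,x_j)\}_{j=0}^k)=\prod_{j=1}^k\mathbf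 1\big[(\Lambda_{n_j}+x_j)\cap(\Lambda_{n_{P_T(j)}}+x_{P_T(j)})\ne\emptyset\big].$$ Let $\mathcal S_{\ell,k}$ be the set of strictly increasing maps $\pi:\{\ell,\dots,k\}\to\{1,\dots,k\}$, and write $J_\pi=\{\pi(\ell),\dots,\pi(k)\}$. For $\alpha\ge0$ and times $t_1,\dots,t_k$ set $$\Re_{T,\alpha}=\sum_{\ell=1}^k(2\alpha)^{k-\ell+1}\sum_{\pi\in\mathcal S_{\ell,k}}\Big(\prod_{j\in J_\pi}|t_j|e^{4\mathbf D\alpha|t_j|}\Big)\sum_{(n_j)_{j\in J_\pi}:\,n_j\ge m_j+1}\ \sum_{(z_j):\,z_j\in\Lambda_{m_j}}\ \sum_{(y_j):\,y_j\in\Lambda_{n_j}\setminus\Lambda_{n_j-1}}\varkappa_T(\{(n_j,x_j)\}_{j=0}^k)\prod_{j\in J_\pi}\mathbf F(|z_j-y_j|),$$ where $n_j=m_j$ for $j\in\{0,\dots,k\}\setminus J_\pi$. **Theorem (Lieb–Robinson bounds for multi-commutators, non-autonomous case).** Under these assumptions the infinite-volume dynamics $\tau_{t,s}$ exists, and for all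 $s\in\mathbb R$, all integers $k\ge1$, all $m_0,\dots,m_k\in\mathbb N_0$, $s_1,\dots,s_k\in\mathbb R$, $x_0,\dots,x_k\in\mathfrak L$, and all $B_0\in\mathcal U_{\Lambda_{m_0}}$ and $B_j\in\mathcal U_{\Lambda_{m_j}}\cap\mathcal U^+$, $1\le j\le k$, $$\Big\|\big[\tau_{s_k,s}\circ\chi_{x_k}(B_k),\dots,\tau_{s_1,s}\circ\chi_{x_1}(B_1),\chi_{x_0}(B_0)\big]^{(k+1)}\Big\|\le 2^k\prod_{j=0}^k\|B_j\|\sum_{T\in\mathcal T_{k+1}}\Big(\varkappa_T(\{(m_j,x_j)\}_{j=0}^k)+\Re_{T,\|\Psi\|_\infty}\Big),$$ with $\Re_{T,\alpha}$ taken at the times $t_j=s_j-s$. -/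

import Mathlib

open scoped NNReal ENNReal

noncomputable section

namespace FermiLattice

/-! ### The lattice `ℤ^d`, cubic boxes, and the Euclidean length -/

/-- The lattice `𝔏 = ℤ^d`. -/
abbrev Lattice (d : ℕ) : Type := Fin d → ℤ

/-- The cubic box `Λ_L = {x : |x_i| ≤ L for all i}`, see `mem_box`. -/
def box {d : ℕ} (L : ℝ) : Finset (Lattice d) :=
  Fintype.piFinset fun _ => Finset.Icc (-⌊L⌋) ⌊L⌋

theorem mem_box {d : ℕ} (L : ℝ) (x : Lattice d) : x ∈ box L ↔ ∀ i, |(x i : ℝ)| ≤ L := by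
  simp only [box, Fintype.mem_piFinset, Finset.mem_Icc]
  refine forall_congr' fun i => ?_
  rw [abs_le, Int.le_floor, neg_le, Int.le_floor, neg_le]
  push_cast
  rw [neg_le]

/-- The translated box `Λ_L + x`. -/
def boxAt {d : ℕ} (L : ℝ) (x : Lattice d) : Finset (Lattice d) :=
  (box L).image fun y => y + x

/-- The Euclidean length `|x|` of a lattice vector. -/
def len {d : ℕ} (x : Lattice d) : ℝ≥0 :=
  ‖(WithLp.toLp 2 fun i => (x i : ℝ) : EuclideanSpace ℝ (Fin d))‖₊

/-! ### The fermion Fock space in occupation-number form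

The antisymmetric Fock space over `ℓ²(ℤ^d)` has an orthonormal basis `e_S` indexed by the finite
sets `S` of occupied sites (fix a total order of the sites and take
`e_S = a*_{x₁} ⋯ a*_{xₙ} Ω` for `S = {x₁ < ⋯ < xₙ}`). It is therefore `ℓ²` of these sets. -/

/-- The fermion Fock space over `ℓ²(ℤ^d)`. -/
abbrev Fock (d : ℕ) : Type := lp (fun _ : Finset (Lattice d) => ℂ) 2

/-- The bounded operator `(T ψ)(S) = c(S) ψ(e S)`, with `|c| ≤ 1` and `e` a bijection. -/
def weightedPerm {d : ℕ} (c : Finset (Lattice d) → ℂ) (e : Equiv.Perm (Finset (Lattice d)))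
    (hc : ∀ S, ‖c S‖ ≤ 1) : Fock d →L[ℂ] Fock d :=
  have h2 : (0 : ℝ) < (2 : ℝ≥0∞).toReal := by norm_num
  have hle : ∀ (ψ : Fock d) (S : Finset (Lattice d)),
      ‖c S * ψ (e S)‖ ^ (2 : ℝ≥0∞).toReal ≤ ‖ψ (e S)‖ ^ (2 : ℝ≥0∞).toReal := fun ψ S => by
    refine Real.rpow_le_rpow (norm_nonneg _) ?_ h2.le
    rw [norm_mul]
    exact mul_le_of_le_one_left (norm_nonneg _) (hc S)
  have hsum : ∀ ψ : Fock d, Summable fun S => ‖ψ (e S)‖ ^ (2 : ℝ≥0∞).toReal := fun ψ =>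
    (Equiv.summable_iff e (f := fun S => ‖ψ S‖ ^ (2 : ℝ≥0∞).toReal)).2
      ((memℓp_gen_iff h2).1 (lp.memℓp ψ))
  have hmem : ∀ ψ : Fock d,
      Memℓp (E := fun _ : Finset (Lattice d) => ℂ) (fun S => c S * ψ (e S)) 2 := fun ψ =>
    (memℓp_gen_iff h2).2 (Summable.of_nonneg_of_le
      (fun S => Real.rpow_nonneg (norm_nonneg _) _) (hle ψ) (hsum ψ))
  LinearMap.mkContinuous
    { toFun := fun ψ => (⟨fun S => c S * ψ (e S), hmem ψ⟩ : Fock d)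
      map_add' := fun ψ φ => by
        ext S
        exact mul_add (c S) (ψ (e S)) (φ (e S))
      map_smul' := fun r ψ => by
        ext S
        simp [mul_left_comm] } 1 (fun ψ => by
      rw [one_mul]
      refine (Real.rpow_le_rpow_iff (norm_nonneg _) (norm_nonneg _) h2).1 ?_
      rw [lp.norm_rpow_eq_tsum h2, lp.norm_rpow_eq_tsum h2,
        ← Equiv.tsum_eq e (fun S => ‖ψ S‖ ^ (2 : ℝ≥0∞).toReal)]
      exact Summable.tsum_le_tsum (hle ψ) ((memℓp_gen_iff h2).1 (hmem ψ)) (hsum ψ))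

@[simp]
theorem weightedPerm_apply {d : ℕ} (c : Finset (Lattice d) → ℂ)
    (e : Equiv.Perm (Finset (Lattice d))) (hc : ∀ S, ‖c S‖ ≤ 1) (ψ : Fock d)
    (S : Finset (Lattice d)) : weightedPerm c e hc ψ S = c S * ψ (e S) := rfl

theorem weightedPerm_norm_le {d : ℕ} (c : Finset (Lattice d) → ℂ)
    (e : Equiv.Perm (Finset (Lattice d))) (hc : ∀ S, ‖c S‖ ≤ 1) (ψ : Fock d) :
    ‖weightedPerm c e hc ψ‖ ≤ ‖ψ‖ := by
  refine (ContinuousLinearMap.le_opNorm _ ψ).trans ?_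
  refine mul_le_of_le_one_left (norm_nonneg _) ?_
  unfold weightedPerm
  exact LinearMap.mkContinuous_norm_le _ zero_le_one _

/-- Adding the site `x` to a configuration if it is empty, removing it if it is occupied. -/
def toggle {d : ℕ} (x : Lattice d) : Equiv.Perm (Finset (Lattice d)) :=
  Function.Involutive.toPerm (fun S => symmDiff S {x}) fun S => by simp

/-- The lexicographic total order of the sites. -/
def SiteLT {d : ℕ} (x y : Lattice d) : Prop := toLex x < toLex y

theorem siteLT_irrefl {d : ℕ} (x : Lattice d) : ¬ SiteLT x x :=
  lt_irrefl (toLex x)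

theorem SiteLT.asymm {d : ℕ} {x y : Lattice d} (h : SiteLT x y) : ¬ SiteLT y x :=
  lt_asymm (a := toLex x) h

theorem siteLT_trichotomy {d : ℕ} (x y : Lattice d) : SiteLT x y ∨ x = y ∨ SiteLT y x :=
  (lt_trichotomy (toLex x) (toLex y)).imp id (Or.imp (fun h => toLex.injective h) id)

theorem siteLT_add_right {d : ℕ} (x y z : Lattice d) : SiteLT (x + z) (y + z) ↔ SiteLT x y :=
  add_lt_add_iff_right (a := toLex z) (b := toLex x) (c := toLex y)

open Classical in
/-- The fermionic sign `(-1)^{#{y ∈ S : y < x}}`, the sites being ordered lexicographically. -/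
def jwSign {d : ℕ} (x : Lattice d) (S : Finset (Lattice d)) : ℂ :=
  (-1) ^ (S.filter fun y => SiteLT y x).card

/-- The annihilation operator at the site `x`: `e_S ↦ ± e_{S \ {x}}` if `x ∈ S`, and `e_S ↦ 0`
otherwise. In coordinates `(a_x ψ)(S) = ± ψ(S ∪ {x})` if `x ∉ S`, and `0` otherwise. -/
def fockA {d : ℕ} (x : Lattice d) : Fock d →L[ℂ] Fock d :=
  weightedPerm (fun S => if x ∈ S then 0 else jwSign x S) (toggle x) fun S => by
    split_ifs <;> simp [jwSign]

/-! ### The CAR algebra -/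

/-- The norm closed `*`-algebra generated by the unit and all annihilation operators. -/
def carSubalgebra (d : ℕ) : StarSubalgebra ℂ (Fock d →L[ℂ] Fock d) :=
  (StarAlgebra.adjoin ℂ (Set.range (fockA (d := d)))).topologicalClosure


theorem isClosed_carSubalgebra (d : ℕ) :
    IsClosed (carSubalgebra d : Set (Fock d →L[ℂ] Fock d)) :=
  StarSubalgebra.isClosed_topologicalClosure _

/-- The lattice CAR `C*`-algebra `𝒰`. -/
def CAR (d : ℕ) : Type := carSubalgebra d

/-- The `C*`-algebra structure that `𝒰` inherits from the bounded operators on the Fock space. -/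
def carCStarAlgebra (d : ℕ) : CStarAlgebra (CAR d) :=
  StarSubalgebra.cstarAlgebra (carSubalgebra d) (h_closed := isClosed_carSubalgebra d)

instance instCStarAlgebraCAR (d : ℕ) : CStarAlgebra (CAR d) := carCStarAlgebra d

/-- The generators `a_x ∈ 𝒰`. -/
def ann {d : ℕ} (x : Lattice d) : CAR d :=
  Subtype.mk (fockA x) (StarSubalgebra.le_topologicalClosure _
    (StarAlgebra.subset_adjoin ℂ _ (Set.mem_range_self x)))

/-- The local CAR algebra `𝒰_Λ`, generated by the unit and `a_x`, `x ∈ Λ`. -/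
def localAlg {d : ℕ} (Λ : Finset (Lattice d)) : StarSubalgebra ℂ (CAR d) :=
  StarAlgebra.adjoin ℂ (ann '' (Λ : Set (Lattice d)))

/-- Conjugation by a unitary of the Fock space that maps generators of `𝒰` into `𝒰`, in both
directions, restricts to a `*`-automorphism of `𝒰`. -/
theorem conj_mem {d : ℕ} (U : Fock d ≃ₗᵢ[ℂ] Fock d)
    (h : ∀ x, U.conjStarAlgEquiv (fockA x) ∈ carSubalgebra d)
    (b : Fock d →L[ℂ] Fock d) (hb : b ∈ carSubalgebra d) :
    U.conjStarAlgEquiv b ∈ carSubalgebra d := by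
  have hcont : Continuous fun b : Fock d →L[ℂ] Fock d => U.conjStarAlgEquiv b := by
    simp only [LinearIsometryEquiv.conjStarAlgEquiv_apply]
    fun_prop
  have hle : StarAlgebra.adjoin ℂ (Set.range (fockA (d := d))) ≤
      (carSubalgebra d).comap (U.conjStarAlgEquiv : _ →⋆ₐ[ℂ] _) := by
    refine StarAlgebra.adjoin_le ?_
    rintro _ ⟨x, rfl⟩
    exact h x
  have hcl := (isClosed_carSubalgebra d).preimage hcont
  exact StarSubalgebra.topologicalClosure_minimal hle hcl hb

/-- The `*`-automorphism of `𝒰` obtained by conjugation with a unitary of the Fock space. -/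
def conjAut {d : ℕ} (U : Fock d ≃ₗᵢ[ℂ] Fock d)
    (h : ∀ x, U.conjStarAlgEquiv (fockA x) ∈ carSubalgebra d)
    (h' : ∀ x, U.symm.conjStarAlgEquiv (fockA x) ∈ carSubalgebra d) : CAR d ≃⋆ₐ[ℂ] CAR d where
  toFun b := Subtype.mk (U.conjStarAlgEquiv b.1) (conj_mem U h b.1 b.2)
  invFun b := Subtype.mk (U.symm.conjStarAlgEquiv b.1) (conj_mem U.symm h' b.1 b.2)
  left_inv b := Subtype.ext (by ext; simp)
  right_inv b := Subtype.ext (by ext; simp)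
  map_mul' a b := Subtype.ext (map_mul U.conjStarAlgEquiv a.1 b.1)
  map_add' a b := Subtype.ext (map_add U.conjStarAlgEquiv a.1 b.1)
  map_star' a := Subtype.ext (map_star U.conjStarAlgEquiv a.1)
  map_smul' r a := Subtype.ext (map_smul U.conjStarAlgEquiv r a.1)

theorem weighted_inv {d : ℕ} (c c' : Finset (Lattice d) → ℂ)
    (e : Equiv.Perm (Finset (Lattice d))) (hc : ∀ S, ‖c S‖ ≤ 1) (hc' : ∀ S, ‖c' S‖ ≤ 1)
    (h : ∀ S, c' S * c (e.symm S) = 1) (ψ : Fock d) :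
    weightedPerm c' e.symm hc' (weightedPerm c e hc ψ) = ψ := by
  ext S
  simp [← mul_assoc, h]

/-- The unitary `(U ψ)(S) = c(S) ψ(e S)` with inverse `(U⁻¹ ψ)(S) = c'(S) ψ(e⁻¹ S)`. -/
def weightedUnitary {d : ℕ} (c c' : Finset (Lattice d) → ℂ)
    (e : Equiv.Perm (Finset (Lattice d))) (hc : ∀ S, ‖c S‖ ≤ 1) (hc' : ∀ S, ‖c' S‖ ≤ 1)
    (h : ∀ S, c' S * c (e.symm S) = 1) : Fock d ≃ₗᵢ[ℂ] Fock d :=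
  { toFun := weightedPerm c e hc
    invFun := weightedPerm c' e.symm hc'
    map_add' := map_add _
    map_smul' := map_smul _
    left_inv := weighted_inv c c' e hc hc' h
    right_inv := weighted_inv c' c e.symm hc' hc fun S => by
      have := h (e S)
      rwa [Equiv.symm_apply_apply, mul_comm] at this
    norm_map' := fun ψ => le_antisymm (weightedPerm_norm_le c e hc ψ)
      ((congrArg norm (weighted_inv c c' e hc hc' h ψ)).ge.trans
        (weightedPerm_norm_le c' e.symm hc' (weightedPerm c e hc ψ))) }

theorem weightedUnitary_apply {d : ℕ} (c c' : Finset (Lattice d) → ℂ)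
    (e : Equiv.Perm (Finset (Lattice d))) (hc : ∀ S, ‖c S‖ ≤ 1) (hc' : ∀ S, ‖c' S‖ ≤ 1)
    (h : ∀ S, c' S * c (e.symm S) = 1) (ψ : Fock d) (S : Finset (Lattice d)) :
    weightedUnitary c c' e hc hc' h ψ S = c S * ψ (e S) := rfl

theorem weightedUnitary_symm_apply {d : ℕ} (c c' : Finset (Lattice d) → ℂ)
    (e : Equiv.Perm (Finset (Lattice d))) (hc : ∀ S, ‖c S‖ ≤ 1) (hc' : ∀ S, ‖c' S‖ ≤ 1)
    (h : ∀ S, c' S * c (e.symm S) = 1) (ψ : Fock d) (S : Finset (Lattice d)) :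
    (weightedUnitary c c' e hc hc' h).symm ψ S = c' S * ψ (e.symm S) := rfl

/-- The lattice translation by `z` on configurations, in the form `S ↦ S - z`. -/
def shiftConf {d : ℕ} (z : Lattice d) : Equiv.Perm (Finset (Lattice d)) :=
  (Equiv.addRight (-z)).finsetCongr

/-- The unitary `e_S ↦ e_{S + z}`. -/
def shiftU {d : ℕ} (z : Lattice d) : Fock d ≃ₗᵢ[ℂ] Fock d :=
  weightedUnitary (fun _ => 1) (fun _ => 1) (shiftConf z) (by simp) (by simp) (by simp)

/-- The unitary `e_S ↦ (-1)^{|S|} e_S`. -/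
def parityU (d : ℕ) : Fock d ≃ₗᵢ[ℂ] Fock d :=
  weightedUnitary (fun S => (-1) ^ S.card) (fun S => (-1) ^ S.card) (Equiv.refl _)
    (by simp) (by simp) (fun S => by simp [← mul_pow])

theorem toggle_apply {d : ℕ} (x : Lattice d) (S : Finset (Lattice d)) :
    toggle x S = symmDiff S {x} := rfl

theorem mem_shiftConf {d : ℕ} (z y : Lattice d) (S : Finset (Lattice d)) :
    y ∈ shiftConf z S ↔ y + z ∈ S := by
  simp [shiftConf]

theorem shiftConf_symm {d : ℕ} (z : Lattice d) : (shiftConf z).symm = shiftConf (-z) := by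
  ext S y
  rw [mem_shiftConf]
  have := mem_shiftConf z (y + -z) ((shiftConf z).symm S)
  rw [Equiv.apply_symm_apply, neg_add_cancel_right] at this
  exact this.symm

theorem jwSign_shiftConf {d : ℕ} (z x : Lattice d) (S : Finset (Lattice d)) :
    jwSign x (shiftConf z S) = jwSign (x + z) S := by
  classical
  unfold jwSign
  congr 1
  refine Finset.card_bij (fun y _ => y + z) ?_ ?_ ?_
  · intro y hy
    rw [Finset.mem_filter, mem_shiftConf] at hy
    rw [Finset.mem_filter]
    exact ⟨hy.1, (siteLT_add_right y x z).2 hy.2⟩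
  · intro y _ y' _ h
    exact add_right_cancel h
  · intro y hy
    rw [Finset.mem_filter] at hy
    refine ⟨y - z, ?_, sub_add_cancel y z⟩
    rw [Finset.mem_filter, mem_shiftConf, sub_add_cancel]
    refine ⟨hy.1, (siteLT_add_right (y - z) x z).1 ?_⟩
    rw [sub_add_cancel]
    exact hy.2

theorem shiftU_apply {d : ℕ} (z : Lattice d) (ψ : Fock d) (S : Finset (Lattice d)) :
    shiftU z ψ S = ψ (shiftConf z S) := by
  rw [shiftU, weightedUnitary_apply, one_mul]

theorem shiftU_symm {d : ℕ} (z : Lattice d) : (shiftU z).symm = shiftU (-z) := by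
  ext ψ S
  rw [shiftU_apply, ← shiftConf_symm, shiftU, weightedUnitary_symm_apply, one_mul]

theorem shiftU_conj {d : ℕ} (z x : Lattice d) :
    (shiftU z).conjStarAlgEquiv (fockA x) = fockA (x + z) := by
  ext ψ S
  have h : (shiftConf z).symm (toggle x (shiftConf z S)) = toggle (x + z) S := by
    rw [Equiv.symm_apply_eq]
    ext y
    simp [toggle_apply, mem_shiftConf, Finset.mem_symmDiff]
  rw [LinearIsometryEquiv.conjStarAlgEquiv_apply_apply, shiftU_symm, shiftU_apply, fockA, fockA,
    weightedPerm_apply, weightedPerm_apply, shiftU_apply, ← shiftConf_symm, h, jwSign_shiftConf]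
  simp only [mem_shiftConf]

theorem parityU_apply {d : ℕ} (ψ : Fock d) (S : Finset (Lattice d)) :
    parityU d ψ S = (-1) ^ S.card * ψ S := rfl

theorem parityU_symm (d : ℕ) : (parityU d).symm = parityU d := by
  ext ψ S
  rfl

theorem parityU_conj {d : ℕ} (x : Lattice d) :
    (parityU d).conjStarAlgEquiv (fockA x) = -fockA x := by
  ext ψ S
  rw [LinearIsometryEquiv.conjStarAlgEquiv_apply_apply, parityU_symm, parityU_apply]
  change _ = -(fockA x ψ S)
  rw [fockA, weightedPerm_apply, weightedPerm_apply, parityU_apply]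
  split_ifs with hx
  · simp
  · have h : toggle x S = insert x S := by
      ext y
      simp only [toggle_apply, Finset.mem_symmDiff, Finset.mem_singleton, Finset.mem_insert]
      by_cases hy : y = x
      · subst hy; simp [hx]
      · simp [hy]
    have h1 : ((-1 : ℂ) ^ S.card) * (-1) ^ S.card = 1 := by simp [← mul_pow]
    rw [h, Finset.card_insert_of_notMem hx, pow_succ]
    linear_combination (-(jwSign x S * ψ (insert x S))) * h1

/-- The group of lattice translations: the `*`-automorphism `χ_z` of `𝒰` with
`χ_z(a_x) = a_{x + z}`, see `translation_ann`. -/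
def translation {d : ℕ} (z : Lattice d) : CAR d ≃⋆ₐ[ℂ] CAR d :=
  conjAut (shiftU z) (fun x => by rw [shiftU_conj]; exact (ann (x + z)).2)
    (fun x => by rw [shiftU_symm, shiftU_conj]; exact (ann (x + -z)).2)

theorem translation_ann {d : ℕ} (z x : Lattice d) : translation z (ann x) = ann (x + z) :=
  Subtype.ext (shiftU_conj z x)

/-- The parity automorphism `σ_π` of `𝒰` with `σ_π(a_x) = -a_x`, see `parity_ann`. -/
def parity (d : ℕ) : CAR d ≃⋆ₐ[ℂ] CAR d :=
  conjAut (parityU d) (fun x => by rw [parityU_conj]; exact neg_mem (ann x).2)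
    (fun x => by rw [parityU_symm, parityU_conj]; exact neg_mem (ann x).2)

theorem parity_ann {d : ℕ} (x : Lattice d) : parity d (ann x) = -ann x :=
  Subtype.ext (parityU_conj x)

/-! The generators satisfy the canonical anti-commutation relations. -/

theorem toggle_toggle {d : ℕ} (x : Lattice d) (S : Finset (Lattice d)) :
    toggle x (toggle x S) = S := by
  simp [toggle_apply]

theorem mem_toggle {d : ℕ} (x y : Lattice d) (S : Finset (Lattice d)) :
    y ∈ toggle x S ↔ (y ∈ S ↔ y ≠ x) := by
  rw [toggle_apply, Finset.mem_symmDiff, Finset.mem_singleton]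
  tauto

theorem toggle_comm {d : ℕ} (x y : Lattice d) (S : Finset (Lattice d)) :
    toggle x (toggle y S) = toggle y (toggle x S) := by
  ext z
  simp only [mem_toggle]
  tauto

theorem jwSign_mul_self {d : ℕ} (x : Lattice d) (S : Finset (Lattice d)) :
    jwSign x S * jwSign x S = 1 := by
  simp [jwSign, ← mul_pow]

open Classical in
theorem jwSign_toggle {d : ℕ} (x y : Lattice d) (S : Finset (Lattice d)) :
    jwSign x (toggle y S) = if SiteLT y x then -jwSign x S else jwSign x S := by
  unfold jwSign
  split_ifs with h
  · by_cases hy : y ∈ S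
    · have : S.filter (fun z => SiteLT z x) =
          insert y ((toggle y S).filter fun z => SiteLT z x) := by
        ext z
        by_cases hz : z = y
        · subst hz; simp [hy, h]
        · simp [mem_toggle, hz]
      rw [this, Finset.card_insert_of_notMem (by simp [mem_toggle, hy])]
      ring
    · have : (toggle y S).filter (fun z => SiteLT z x) =
          insert y (S.filter fun z => SiteLT z x) := by
        ext z
        by_cases hz : z = y
        · subst hz; simp [mem_toggle, hy, h]
        · simp [mem_toggle, hz]
      rw [this, Finset.card_insert_of_notMem (by simp [hy])]
      ring
  · congr 2
    ext z
    by_cases hz : z = y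
    · subst hz; simp [h]
    · simp [mem_toggle, hz]

theorem star_fockA_apply {d : ℕ} (x : Lattice d) (ψ : Fock d) (S : Finset (Lattice d)) :
    (star (fockA x)) ψ S = (if x ∈ S then jwSign x S else 0) * ψ (toggle x S) := by
  have hc : ∀ S : Finset (Lattice d), ‖(if x ∈ S then jwSign x S else 0 : ℂ)‖ ≤ 1 := fun S => by
    split_ifs <;> simp [jwSign]
  have h : weightedPerm (fun S => if x ∈ S then jwSign x S else 0) (toggle x) hc =
      star (fockA x) := by
    rw [ContinuousLinearMap.star_eq_adjoint, ContinuousLinearMap.eq_adjoint_iff]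
    intro u v
    rw [lp.inner_eq_tsum, lp.inner_eq_tsum, ← Equiv.tsum_eq (toggle x)]
    congr 1
    ext S
    rw [fockA, weightedPerm_apply, weightedPerm_apply, toggle_toggle, jwSign_toggle]
    by_cases hx : x ∈ S <;> simp [mem_toggle, hx, siteLT_irrefl, jwSign]
    ring
  rw [← h, weightedPerm_apply]

theorem ann_mul_ann {d : ℕ} (x y : Lattice d) : ann x * ann y + ann y * ann x = 0 := by
  refine Subtype.ext ?_
  change fockA x * fockA y + fockA y * fockA x = 0
  ext ψ S
  change fockA x (fockA y ψ) S + fockA y (fockA x ψ) S = 0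
  simp only [fockA, weightedPerm_apply, mem_toggle, jwSign_toggle, toggle_comm x y]
  rcases siteLT_trichotomy x y with h | h | h
  · have hne : x ≠ y := fun e => siteLT_irrefl y (e ▸ h)
    by_cases hx : x ∈ S <;> by_cases hy : y ∈ S <;>
      simp [hx, hy, hne, hne.symm, h, h.asymm]
    ring
  · have hxy : x = y := h
    subst hxy
    by_cases hx : x ∈ S <;> simp [hx]
  · have hne : x ≠ y := fun e => siteLT_irrefl y (e ▸ h)
    by_cases hx : x ∈ S <;> by_cases hy : y ∈ S <;>
      simp [hx, hy, hne, hne.symm, h, h.asymm]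
    ring

theorem ann_mul_star_ann {d : ℕ} (x y : Lattice d) :
    ann x * star (ann y) + star (ann y) * ann x = if x = y then 1 else 0 := by
  have key : fockA x * star (fockA y) + star (fockA y) * fockA x =
      if x = y then (1 : Fock d →L[ℂ] Fock d) else 0 := by
    ext ψ S
    change fockA x (star (fockA y) ψ) S + star (fockA y) (fockA x ψ) S = _
    rw [star_fockA_apply, fockA, weightedPerm_apply, weightedPerm_apply, star_fockA_apply,
      toggle_comm x y]
    simp only [mem_toggle, jwSign_toggle]
    rcases siteLT_trichotomy x y with h | h | h
    · have hne : x ≠ y := fun e => siteLT_irrefl y (e ▸ h)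
      by_cases hx : x ∈ S <;> by_cases hy : y ∈ S <;>
        simp [hx, hy, hne, hne.symm, h, h.asymm]
      ring
    · have hxy : x = y := h
      subst hxy
      by_cases hx : x ∈ S <;> simp [hx, toggle_toggle, ← mul_assoc, jwSign_mul_self, siteLT_irrefl]
    · have hne : x ≠ y := fun e => siteLT_irrefl y (e ▸ h)
      by_cases hx : x ∈ S <;> by_cases hy : y ∈ S <;>
        simp [hx, hy, hne, hne.symm, h, h.asymm]
      ring
  refine Subtype.ext (Eq.trans key ?_)
  split_ifs <;> rfl

/-- Even elements of `𝒰`, that is, the elements of `𝒰⁺`. -/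
def IsEven {d : ℕ} (b : CAR d) : Prop := parity d b = b

/-! ### Interactions, potentials, decay functions -/

/-- An interaction: a family of even self-adjoint elements `Φ_Λ ∈ 𝒰_Λ`, with `Φ_∅ = 0`. -/
structure Interaction (d : ℕ) where
  toFun : Finset (Lattice d) → CAR d
  isEven : ∀ Λ, IsEven (toFun Λ)
  isSelfAdjoint : ∀ Λ, IsSelfAdjoint (toFun Λ)
  mem_localAlg : ∀ Λ, toFun Λ ∈ localAlg Λ
  map_empty : toFun ∅ = 0

/-- A potential: a family of even self-adjoint elements `V_x ∈ 𝒰_{{x}}`. -/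
structure Potential (d : ℕ) where
  toFun : Lattice d → CAR d
  isEven : ∀ x, IsEven (toFun x)
  isSelfAdjoint : ∀ x, IsSelfAdjoint (toFun x)
  mem_localAlg : ∀ x, toFun x ∈ localAlg {x}

/-- The convolution constant
`sup_{x,y} ∑_z F(|x - z|) F(|z - y|) / F(|x - y|) ∈ [0, ∞]`. -/
def convConst (d : ℕ) (F : ℝ≥0 → ℝ) : ℝ≥0∞ :=
  ⨆ (x : Lattice d) (y : Lattice d), ∑' z : Lattice d,
    ENNReal.ofReal (F (len (x - z)) * F (len (z - y)) / F (len (x - y)))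

/-- Decay functions: positive, non-increasing, summable on the lattice and with finite
convolution constant. -/
structure DecayFunction (d : ℕ) where
  toFun : ℝ≥0 → ℝ
  pos : ∀ r, 0 < toFun r
  antitone : Antitone toFun
  summable : Summable fun x : Lattice d => toFun (len x)
  convConst_lt_top : convConst d toFun < ⊤

/-- The convolution constant `𝐃` of a decay function, as a real number. -/
def DecayFunction.D {d : ℕ} (F : DecayFunction d) : ℝ := (convConst d F.toFun).toReal

/-- The norm `‖Φ‖_𝒲 = sup_{x,y} ∑_{Λ ∋ x,y} ‖Φ_Λ‖ / F(|x - y|) ∈ [0, ∞]`; the space `𝒲` consists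
of the interactions for which it is finite. -/
def Interaction.normW {d : ℕ} (Φ : Interaction d) (F : DecayFunction d) : ℝ≥0∞ :=
  ⨆ (x : Lattice d) (y : Lattice d), ∑' Λ : {Λ : Finset (Lattice d) // x ∈ Λ ∧ y ∈ Λ},
    ENNReal.ofReal (‖Φ.toFun Λ‖ / F.toFun (len (x - y)))

/-- `‖Ψ‖_∞ = sup_t ‖Ψ^{(t)}‖_𝒲 ∈ [0, ∞]` for a time-dependent interaction. -/
def supNormW {d : ℕ} (Ψ : ℝ → Interaction d) (F : DecayFunction d) : ℝ≥0∞ :=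
  ⨆ t : ℝ, (Ψ t).normW F

/-! ### Non-autonomous dynamics -/

/-- The bounded operator `B ↦ [A, B] = A B - B A` on `𝒰`. -/
def commOp {d : ℕ} (A : CAR d) : CAR d →L[ℂ] CAR d :=
  ContinuousLinearMap.mul ℂ (CAR d) A - (ContinuousLinearMap.mul ℂ (CAR d)).flip A

/-- The finite-volume derivation
`δ^{(L)}(B) = i ∑_{Λ ⊆ Λ_L} [Φ_Λ, B] + i ∑_{x ∈ Λ_L} [V_x, B]`. -/
def derivation {d : ℕ} (Φ : Interaction d) (V : Potential d) (L : ℝ≥0) : CAR d →L[ℂ] CAR d :=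
  Complex.I • (∑ Λ ∈ (box (L : ℝ)).powerset, commOp (Φ.toFun Λ)) +
    Complex.I • ∑ x ∈ box (L : ℝ), commOp (V.toFun x)

/-- `τ` is the finite-volume dynamics in `Λ_L`: a solution of
`∂_t τ_{t,s} = τ_{t,s} ∘ δ_t^{(L)}`, `∂_s τ_{t,s} = - δ_s^{(L)} ∘ τ_{t,s}`, `τ_{s,s} = 1`. -/
structure IsFiniteVolumeDynamics {d : ℕ} (Ψ : ℝ → Interaction d) (V : ℝ → Potential d) (L : ℝ≥0)
    (τ : ℝ → ℝ → CAR d →L[ℂ] CAR d) : Prop where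
  deriv_left : ∀ t s, HasDerivAt (fun r => τ r s) (τ t s ∘L derivation (Ψ t) (V t) L) t
  deriv_right : ∀ t s, HasDerivAt (fun r => τ t r) (-(derivation (Ψ s) (V s) L ∘L τ t s)) s
  diag : ∀ s, τ s s = ContinuousLinearMap.id ℂ (CAR d)

/-- `τ` is the infinite-volume dynamics: the strong limit of the finite-volume dynamics as
`L → ∞`. -/
def IsInfiniteVolumeDynamics {d : ℕ} (Ψ : ℝ → Interaction d) (V : ℝ → Potential d)
    (τ : ℝ → ℝ → CAR d →L[ℂ] CAR d) : Prop :=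
  ∃ τL : ℝ≥0 → ℝ → ℝ → CAR d →L[ℂ] CAR d,
    (∀ L, IsFiniteVolumeDynamics Ψ V L (τL L)) ∧
    ∀ t s B, Filter.Tendsto (fun L => τL L t s B) Filter.atTop (nhds (τ t s B))

/-! ### Multi-commutators, trees, and the bound -/

/-- The multi-commutator `[B_k, …, B_0]^{(k+1)} = [B_k, [B_{k-1}, …, [B_1, B_0] … ]]`. -/
def multiComm {A : Type*} [Ring A] (B : ℕ → A) : ℕ → A
  | 0 => B 0
  | k + 1 => B (k + 1) * multiComm B k - multiComm B k * B (k + 1)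

/-- `trees k` is the set `𝒯_{k+1}` of trees on the vertices `0, …, k`, each given by its set of
bonds: `𝒯_{k+2} = {T ∪ {{j, k+1}} : j ≤ k, T ∈ 𝒯_{k+1}}`, starting from the tree without bonds
on the vertex `0`; in particular `𝒯_2 = {{{0, 1}}}`. -/
def trees : ℕ → Finset (Finset (Sym2 ℕ))
  | 0 => {∅}
  | k + 1 => (Finset.range (k + 1) ×ˢ trees k).image fun p => insert s(p.1, k + 1) p.2

/-- The parent map `P_T`: for `T ∈ 𝒯_{k+1}` and `1 ≤ j ≤ k`, the only vertex `i < j` which is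
joined to `j` by a bond of `T`. -/
def parent (T : Finset (Sym2 ℕ)) (j : ℕ) : ℕ := sInf {i | i < j ∧ s(i, j) ∈ T}

/-- The characteristic function `ϰ_T({(n_j, x_j)}_{j=0}^k) ∈ {0, 1}`. -/
def kappa {d : ℕ} (k : ℕ) (T : Finset (Sym2 ℕ)) (n : ℕ → ℕ) (x : ℕ → Lattice d) : ℝ :=
  ∏ j ∈ Finset.Icc 1 k,
    if (boxAt (n j) (x j) ∩ boxAt (n (parent T j)) (x (parent T j))).Nonempty then 1 else 0

open Classical in
/-- The set `𝒮_{ℓ,k}` of strictly increasing maps `{ℓ, …, k} → {1, …, k}`. -/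
def increasingMaps (l k : ℕ) : Finset (Finset.Icc l k → Finset.Icc 1 k) :=
  Finset.univ.filter StrictMono

/-- The image `{π(ℓ), …, π(k)}`. -/
def imageSet {l k : ℕ} (π : Finset.Icc l k → Finset.Icc 1 k) : Finset ℕ :=
  Finset.univ.image fun i => (π i : ℕ)

/-- The sequence equal to `n_j` for `j ∈ J` and to `m_j` for all other `j`. -/
def extendBy (J : Finset ℕ) (n : J → ℕ) (m : ℕ → ℕ) (j : ℕ) : ℕ :=
  if h : j ∈ J then n ⟨j, h⟩ else m j

/-- The quantity `ℜ_{T,α}`, with times `t_1, …, t_k`. The sums over `n_j ≥ m_j + 1`,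
`z_j ∈ Λ_{m_j}`, `y_j ∈ Λ_{n_j} \ Λ_{n_j - 1}`, `j ∈ J = {π(ℓ), …, π(k)}`, are written as sums
over families indexed by `J`. -/
def remainder {d : ℕ} (F : DecayFunction d) (k : ℕ) (T : Finset (Sym2 ℕ)) (α : ℝ) (t : ℕ → ℝ)
    (m : ℕ → ℕ) (x : ℕ → Lattice d) : ℝ :=
  ∑ l ∈ Finset.Icc 1 k, (2 * α) ^ (k - l + 1) * ∑ π ∈ increasingMaps l k,
    (∏ j ∈ imageSet π, |t j| * Real.exp (4 * F.D * α * |t j|)) *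
      ∑' n : {n : imageSet π → ℕ // ∀ j : imageSet π, m j + 1 ≤ n j},
        ∑ z ∈ Fintype.piFinset fun j : imageSet π => box (d := d) (m j),
          ∑ y ∈ Fintype.piFinset fun j : imageSet π =>
              box (d := d) (n.1 j) \ box ((n.1 j : ℝ) - 1),
            kappa k T (extendBy (imageSet π) n.1 m) x *
              ∏ j : imageSet π, F.toFun (len (z j - y j))

end FermiLattice

end

namespace FermiLattice

/-! ### Norm estimates from derivative bounds -/

section MeanValue

variable {E : Type*} [NormedAddCommGroup E] [NormedSpace ℝ E]

/-! For $j \ge 1$ the evolved observable $\tau_{s_j,s}(\chi_{x_j}(B_j))$ is the limit of a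
telescoping sum over $n \ge m_j$. The term $n = m_j$ evolves $\chi_{x_j}(B_j)$ by the dynamics of
the box $\Lambda_{m_j}+x_j$. A term $n > m_j$ is the difference between the dynamics of $\Lambda_n +
x_j$ and of $\Lambda_{n-1}+x_j$. Each term is even and localized exactly in $\Lambda_n + x_j$,
because the unitary propagator of a finite region is built inside the closed even algebra of that
region (`exists_isUnitaryPropagator`).

The multi-commutator is multilinear (`multiComm_sum`), so it splits into multi-commutators of
strictly localized elements. Such a multi-commutator vanishes unless the support of each entry meets
the support of an earlier one (`exists_inter_nonempty_of_multiComm_ne_zero`). Choosing one such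
earlier entry for every $j$ gives a tree $T$ with $\varkappa_T = 1$, so the trivial bound
$2^k\prod\|\cdot\|$ may be multiplied by $\sum_T \varkappa_T$ (`norm_multiComm_le_sum_kappa`).

What remains is the size of the differences, which is analytic (`norm_conj_sub_conj_le`). By
interpolation between two volumes, the difference is controlled by commutators of the evolved
observable with the interaction terms that leave the smaller region. These are bounded by a
finite-volume Lieb–Robinson estimate (`norm_commutator_conj_le_lrKern`). The estimate is independent
of the on-site potentials, which an interaction picture removes (`norm_commutator_conj_le`). The
result is a factor $2\alpha|t|e^{2\mathbf D\alpha|t|}\sum_{z,y}\mathbf F(|z-y|)$, with $y$ in the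
shell.

Grouping the expansion by the set $J$ of indices with $n_j \ne m_j$ gives $\varkappa_T$ for
$J=\emptyset$ and the terms of $\Re_{T,\alpha}$ for the other $J$
(`sum_multiIndices_le_kappa_add_remainder`). The same comparison of volumes gives existence of the
dynamics: the local evolutions are Cauchy along all finite regions. Hence boxes centred at $x_j$ may
replace those centred at the origin. -/

theorem exists_affine_reparam (s t : ℝ) :
    ∃ ε : ℝ, |ε| = 1 ∧ s + ε * |t - s| = t ∧ ∀ u, |s + ε * u - s| = |u| := by
  rcases le_total s t with h | h
  · exact ⟨1, by simp, by rw [abs_of_nonneg (sub_nonneg.2 h)]; ring, fun u => by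
      congr 1; ring⟩
  · refine ⟨-1, by simp, by rw [abs_of_nonpos (sub_nonpos.2 h)]; ring, fun u => ?_⟩
    rw [show s + -1 * u - s = -u by ring, abs_neg]

theorem hasDerivAt_comp_reparam {f f' : ℝ → E} (hf : ∀ r, HasDerivAt f (f' r) r) (s ε u : ℝ) :
    HasDerivAt (fun u => f (s + ε * u)) (ε • f' (s + ε * u)) u := by
  have h1 : HasDerivAt (fun u : ℝ => s + ε * u) ε u := by
    simpa using ((hasDerivAt_id u).const_mul ε).const_add s
  exact (hf (s + ε * u)).scomp u h1

/-- If `‖f s‖ ≤ β 0` and `‖f' r‖ ≤ β' |r - s|` between `s` and `t`, then `‖f t‖ ≤ β |t - s|`. -/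
theorem norm_le_of_norm_deriv_le {f f' : ℝ → E} {β β' : ℝ → ℝ} (s t : ℝ)
    (hf : ∀ r, HasDerivAt f (f' r) r) (hβ : ∀ u, HasDerivAt β (β' u) u) (h0 : ‖f s‖ ≤ β 0)
    (h : ∀ r, |r - s| ≤ |t - s| → ‖f' r‖ ≤ β' |r - s|) : ‖f t‖ ≤ β |t - s| := by
  obtain ⟨ε, hε, hst, hu⟩ := exists_affine_reparam s t
  have hg := hasDerivAt_comp_reparam hf s ε
  have key := image_norm_le_of_norm_deriv_right_le_deriv_boundary (a := 0) (b := |t - s|)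
    (f := fun u => f (s + ε * u)) (f' := fun u => ε • f' (s + ε * u)) (B := β) (B' := β')
    (fun u _ => (hg u).continuousAt.continuousWithinAt)
    (fun u _ => (hg u).hasDerivWithinAt) (by simpa using h0) hβ (fun u hu' => ?_)
    (x := |t - s|) ⟨abs_nonneg _, le_rfl⟩
  · simpa [hst] using key
  · have h3 : |s + ε * u - s| = u := by rw [hu, abs_of_nonneg hu'.1]
    have := h (s + ε * u) (by rw [h3]; exact hu'.2.le)
    rw [h3] at this
    rwa [norm_smul, Real.norm_eq_abs, hε, one_mul]

theorem norm_sub_le_of_norm_deriv_le {f f' : ℝ → E} {C : ℝ} (s t : ℝ)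
    (hf : ∀ r, HasDerivAt f (f' r) r)
    (h : ∀ r, |r - s| ≤ |t - s| → |t - r| ≤ |t - s| → ‖f' r‖ ≤ C) :
    ‖f t - f s‖ ≤ C * |t - s| := by
  have := Convex.norm_image_sub_le_of_norm_hasDerivWithin_le (f := f) (f' := f') (C := C)
    (s := Set.uIcc s t) (x := s) (y := t) (fun r _ => (hf r).hasDerivWithinAt)
    (fun r hr => h r (Set.abs_sub_left_of_mem_uIcc hr) (Set.abs_sub_right_of_mem_uIcc hr))
    (convex_uIcc s t) Set.left_mem_uIcc Set.right_mem_uIcc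
  rwa [Real.norm_eq_abs] at this

/-- Grönwall uniqueness in either time direction: the continuous rate is bounded on the compact
interval between the two times. -/
theorem eq_zero_of_norm_deriv_le_mul {f f' : ℝ → E} {k : ℝ → ℝ} (hk : Continuous k) (s t : ℝ)
    (hf : ∀ r, HasDerivAt f (f' r) r) (h0 : f s = 0) (h : ∀ r, ‖f' r‖ ≤ k r * ‖f r‖) :
    f t = 0 := by
  obtain ⟨ε, hε, hst, hu⟩ := exists_affine_reparam s t
  have hg := hasDerivAt_comp_reparam hf s ε
  obtain ⟨M, hM⟩ := (isCompact_Icc (a := 0) (b := |t - s|)).bddAbove_image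
    (f := fun u => k (s + ε * u)) (by fun_prop)
  have key := eq_zero_of_abs_deriv_le_mul_abs_self_of_eq_zero_right (a := 0) (b := |t - s|)
    (f := fun u => f (s + ε * u)) (f' := fun u => ε • f' (s + ε * u)) (K := M)
    (fun u _ => (hg u).continuousAt.continuousWithinAt)
    (fun u _ => (hg u).hasDerivWithinAt) (by simpa using h0) (fun u hu' => ?_)
    |t - s| ⟨abs_nonneg _, le_rfl⟩
  · simpa [hst] using key
  · rw [norm_smul, Real.norm_eq_abs, hε, one_mul]
    exact (h _).trans (mul_le_mul_of_nonneg_right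
      (hM ⟨u, Set.Ico_subset_Icc_self hu', rfl⟩) (norm_nonneg _))

end MeanValue

/-! ### Linear evolution equations in Banach algebras -/

section Dyson

variable {𝔸 : Type*} [NormedRing 𝔸] [NormedAlgebra ℝ 𝔸]

/-- The terms of the Dyson series for `P' = P K`, `P 0 = 1`. -/
noncomputable def dysonTerm (K : ℝ → 𝔸) : ℕ → ℝ → 𝔸
  | 0, _ => 1
  | n + 1, t => ∫ r in (0 : ℝ)..t, dysonTerm K n r * K r

theorem continuous_dysonTerm {K : ℝ → 𝔸} (hK : Continuous K) (n : ℕ) :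
    Continuous (dysonTerm K n) := by
  induction n with
  | zero => exact continuous_const
  | succ n ih =>
    exact intervalIntegral.continuous_primitive
      (fun a b => (ih.mul hK).intervalIntegrable a b) 0

theorem hasDerivAt_dysonTerm_succ [CompleteSpace 𝔸] {K : ℝ → 𝔸} (hK : Continuous K) (n : ℕ) (t : ℝ) :
    HasDerivAt (dysonTerm K (n + 1)) (dysonTerm K n t * K t) t :=
  ((continuous_dysonTerm hK n).mul hK).integral_hasStrictDerivAt 0 t |>.hasDerivAt

theorem norm_dysonTerm_le [CompleteSpace 𝔸] {K : ℝ → 𝔸} (hK : Continuous K) {M T : ℝ}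
    (hM : ∀ r, |r| ≤ T → ‖K r‖ ≤ M) (n : ℕ) (t : ℝ) (ht : |t| ≤ T) :
    ‖dysonTerm K n t‖ ≤ ‖(1 : 𝔸)‖ * ((M * |t|) ^ n / n.factorial) := by
  induction n generalizing t with
  | zero => simp [dysonTerm]
  | succ n ih =>
    have hβ : ∀ u, HasDerivAt (fun u : ℝ => ‖(1 : 𝔸)‖ * ((M * u) ^ (n + 1) / (n + 1).factorial))
        (‖(1 : 𝔸)‖ * ((M * u) ^ n / n.factorial) * M) u := fun u => by
      have h1 : HasDerivAt (fun u : ℝ => M * u) M u := by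
        simpa using (hasDerivAt_id u).const_mul M
      have h2 := ((h1.pow (n + 1)).div_const ((n + 1).factorial : ℝ)).const_mul ‖(1 : 𝔸)‖
      refine h2.congr_deriv ?_
      rw [Nat.factorial_succ]
      have : (n.factorial : ℝ) ≠ 0 := by positivity
      push_cast
      field_simp
    have := norm_le_of_norm_deriv_le 0 t (hasDerivAt_dysonTerm_succ hK n) hβ
      (by simp [dysonTerm]) (fun r hr => ?_)
    · simpa using this
    · simp only [sub_zero] at hr ⊢
      refine (norm_mul_le _ _).trans ?_
      refine mul_le_mul (ih r (hr.trans ht)) (hM r (hr.trans ht)) (norm_nonneg _) ?_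
      exact (norm_nonneg _).trans (ih r (hr.trans ht))

/-- The Dyson series is dominated by an exponential series, uniformly for $|r| \le |t|+1$, so it may
be differentiated term by term near $t$. Differentiation lowers the index by one and produces the
factor $K$. -/
theorem exists_hasDerivAt_mul [CompleteSpace 𝔸] {K : ℝ → 𝔸} (hK : Continuous K) :
    ∃ P : ℝ → 𝔸, P 0 = 1 ∧ ∀ t, HasDerivAt P (P t * K t) t := by
  refine ⟨fun t => ∑' n, dysonTerm K n t, ?_, fun t => ?_⟩
  · change ∑' n, dysonTerm K n 0 = 1
    rw [tsum_eq_single 0]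
    · rfl
    · intro n hn
      obtain ⟨n, rfl⟩ := Nat.exists_eq_succ_of_ne_zero hn
      simp [dysonTerm]
  · obtain ⟨M, hM⟩ := (isCompact_Icc (a := -(|t| + 1)) (b := |t| + 1)).bddAbove_image
      (f := fun r => ‖K r‖) (by fun_prop)
    have hM' : ∀ r, |r| ≤ |t| + 1 → ‖K r‖ ≤ M := fun r hr => hM ⟨r, abs_le.1 hr, rfl⟩
    have hM0 : 0 ≤ M := (norm_nonneg _).trans (hM' t (by linarith))
    set T := |t| + 1 with hT
    have hT0 : 0 ≤ T := by positivity
    have hs : Summable fun n : ℕ => ‖(1 : 𝔸)‖ * ((M * T) ^ n / n.factorial) :=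
      (Real.summable_pow_div_factorial _).mul_left _
    have hbd : ∀ n r, |r| ≤ T → ‖dysonTerm K n r‖ ≤
        ‖(1 : 𝔸)‖ * ((M * T) ^ n / n.factorial) := fun n r hr =>
      (norm_dysonTerm_le hK hM' n r hr).trans (by gcongr)
    have hsum : ∀ r, |r| ≤ T → Summable fun n => dysonTerm K n r := fun r hr =>
      Summable.of_norm_bounded hs (fun n => hbd n r hr)
    have hder := hasDerivAt_tsum_of_isPreconnected (𝕜 := ℝ) (t := Set.Ioo (-T) T)
      (g := fun n => dysonTerm K (n + 1)) (g' := fun n r => dysonTerm K n r * K r)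
      (y₀ := 0) (y := t) (hs.mul_right M) isOpen_Ioo isPreconnected_Ioo
      (fun n r _ => hasDerivAt_dysonTerm_succ hK n r)
      (fun n r hr => (norm_mul_le _ _).trans (mul_le_mul
        (hbd n r (abs_le.2 ⟨hr.1.le, hr.2.le⟩)) (hM' r (abs_le.2 ⟨hr.1.le, hr.2.le⟩))
        (norm_nonneg _) (by positivity)))
      ⟨by rw [hT]; linarith [abs_nonneg t], by positivity⟩
      ((summable_nat_add_iff 1).2 (hsum 0 (by simpa using hT0)))
      (abs_lt.1 (by rw [hT]; linarith))
    rw [(hsum t (by rw [hT]; linarith)).tsum_mul_right] at hder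
    have heq : (fun r => ∑' n, dysonTerm K n r) =ᶠ[nhds t]
        fun r => 1 + ∑' n, dysonTerm K (n + 1) r := by
      filter_upwards [Ioo_mem_nhds (a := -T) (b := T) (x := t) (by
        rw [hT]; linarith [neg_abs_le t]) (by rw [hT]; linarith [le_abs_self t])] with r hr
      rw [(hsum r (abs_le.2 ⟨hr.1.le, hr.2.le⟩)).tsum_eq_zero_add]
      rfl
    exact (hder.const_add 1).congr_of_eventuallyEq heq

end Dyson

/-! ### Unitary propagators in `C*`-algebras -/

section Propagator

variable {A : Type*} [CStarAlgebra A]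

/-- `W` is the two-parameter unitary family with `∂_t W_{t,s} = W_{t,s} K_t`,
`∂_s W_{t,s} = - K_s W_{t,s}` and `W_{s,s} = 1`. -/
structure IsUnitaryPropagator (K : ℝ → A) (W : ℝ → ℝ → A) : Prop where
  deriv_left : ∀ t s, HasDerivAt (fun r => W r s) (W t s * K t) t
  deriv_right : ∀ t s, HasDerivAt (fun r => W t r) (-(K s * W t s)) s
  diag : ∀ s, W s s = 1
  mem_unitary : ∀ t s, W t s ∈ unitary A

theorem hasDerivAt_star {f : ℝ → A} {f' : A} {t : ℝ} (hf : HasDerivAt f f' t) :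
    HasDerivAt (fun r => star (f r)) (star f') t :=
  hf.star

/-- The equation is solved inside the Banach algebra `S`, so membership of the propagator in `S` is
automatic; with `S` a closed local algebra this is locality. With $P' = PK$ and $P_0 = 1$, the
propagator is $W_{t,s} = P_s^* P_t$. -/
theorem exists_isUnitaryPropagator (S : StarSubalgebra ℂ A) (hS : IsClosed (S : Set A))
    {K : ℝ → A} (hK : Continuous K) (hKs : ∀ t, star (K t) = -K t) (hKS : ∀ t, K t ∈ S) :
    ∃ W : ℝ → ℝ → A, IsUnitaryPropagator K W ∧ ∀ t s, W t s ∈ S := by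
  obtain ⟨P, hP0, hPd, hPS⟩ : ∃ P : ℝ → A, P 0 = 1 ∧ (∀ t, HasDerivAt P (P t * K t) t) ∧
      ∀ t, P t ∈ S := by
    have : CompleteSpace S := hS.completeSpace_coe
    obtain ⟨P, hP0, hPd⟩ := exists_hasDerivAt_mul (𝔸 := S) (K := fun t => ⟨K t, hKS t⟩)
      (by fun_prop)
    refine ⟨fun t => P t, congrArg Subtype.val hP0, fun t => ?_, fun t => (P t).2⟩
    let ι : S →L[ℝ] A := LinearMap.mkContinuous
      { toFun := fun x => (x : A), map_add' := fun _ _ => rfl, map_smul' := fun _ _ => rfl } 1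
      (fun x => by rw [one_mul]; exact le_rfl)
    exact ι.hasFDerivAt.comp_hasDerivAt t (hPd t)
  have hQd : ∀ t, HasDerivAt (fun r => star (P r)) (-(K t * star (P t))) t := fun t => by
    have := hasDerivAt_star (hPd t)
    rwa [star_mul, hKs, neg_mul] at this
  have hPQ : ∀ t, P t * star (P t) = 1 := fun t => by
    have h0 : ∀ r, HasDerivAt (fun r => P r * star (P r) - 1) 0 r := fun r => by
      refine (((hPd r).mul (hQd r)).sub_const 1).congr_deriv ?_
      noncomm_ring
    refine sub_eq_zero.1 (eq_zero_of_norm_deriv_le_mul (k := fun _ => 0) continuous_const 0 t h0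
      (by simp [hP0]) (by simp))
  -- In infinite dimensions this does not follow from $PP^* = 1$. Here the derivative is not
  -- identically zero but the commutator $[P^*P - 1, K]$, so Grönwall is needed.
  have hQP : ∀ t, star (P t) * P t = 1 := fun t => by
    have h0 : ∀ r, HasDerivAt (fun r => star (P r) * P r - 1)
        ((star (P r) * P r - 1) * K r - K r * (star (P r) * P r - 1)) r := fun r => by
      refine (((hQd r).mul (hPd r)).sub_const 1).congr_deriv ?_
      noncomm_ring
    refine sub_eq_zero.1 (eq_zero_of_norm_deriv_le_mul (k := fun r => 2 * ‖K r‖) (by fun_prop) 0 t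
      h0 (by simp [hP0]) (fun r => ?_))
    refine (norm_sub_le _ _).trans ?_
    have h1 := norm_mul_le (star (P r) * P r - 1) (K r)
    have h2 := norm_mul_le (K r) (star (P r) * P r - 1)
    linarith
  refine ⟨fun t s => star (P s) * P t, ⟨fun t s => ?_, fun t s => ?_, hQP, fun t s => ?_⟩,
    fun t s => mul_mem (star_mem (hPS s)) (hPS t)⟩
  · exact ((hPd t).const_mul (star (P s))).congr_deriv (by rw [mul_assoc])
  · exact ((hQd s).mul_const (P t)).congr_deriv (by noncomm_ring)
  · rw [Unitary.mem_iff]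
    constructor
    · rw [star_mul, star_star, mul_assoc, ← mul_assoc (P s), hPQ, one_mul, hQP]
    · rw [star_mul, star_star, mul_assoc, ← mul_assoc (P t), hPQ, one_mul, hQP]

namespace IsUnitaryPropagator

variable {K : ℝ → A} {W : ℝ → ℝ → A}

theorem star_mul_self (hW : IsUnitaryPropagator K W) (t s : ℝ) : star (W t s) * W t s = 1 :=
  Unitary.star_mul_self_of_mem (hW.mem_unitary t s)

theorem mul_star_self (hW : IsUnitaryPropagator K W) (t s : ℝ) : W t s * star (W t s) = 1 :=
  Unitary.mul_star_self_of_mem (hW.mem_unitary t s)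

theorem norm_conj (hW : IsUnitaryPropagator K W) (t s : ℝ) (b : A) :
    ‖W t s * b * star (W t s)‖ = ‖b‖ := by
  rw [CStarRing.norm_mul_mem_unitary _ (Unitary.star_mem (hW.mem_unitary t s)),
    CStarRing.norm_mem_unitary_mul _ (hW.mem_unitary t s)]

theorem conj_mul (hW : IsUnitaryPropagator K W) (t s : ℝ) (a b : A) :
    W t s * (a * b) * star (W t s) =
      (W t s * a * star (W t s)) * (W t s * b * star (W t s)) := by
  calc W t s * (a * b) * star (W t s) = W t s * a * 1 * b * star (W t s) := by noncomm_ring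
    _ = _ := by rw [← hW.star_mul_self t s]; noncomm_ring

theorem hasDerivAt_conj_left (hW : IsUnitaryPropagator K W) (hK : ∀ t, star (K t) = -K t)
    {b : ℝ → A} {b' : A} {t : ℝ} (s : ℝ) (hb : HasDerivAt b b' t) :
    HasDerivAt (fun r => W r s * b r * star (W r s))
      (W t s * (b' + (K t * b t - b t * K t)) * star (W t s)) t := by
  refine (((hW.deriv_left t s).mul hb).mul (hasDerivAt_star (hW.deriv_left t s))).congr_deriv ?_
  rw [star_mul, hK, Pi.mul_apply]
  noncomm_ring

theorem hasDerivAt_conj_right (hW : IsUnitaryPropagator K W) (hK : ∀ t, star (K t) = -K t)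
    (b : A) (t s : ℝ) :
    HasDerivAt (fun r => W t r * b * star (W t r))
      (-(K s * (W t s * b * star (W t s)) - (W t s * b * star (W t s)) * K s)) s := by
  refine (((hW.deriv_right t s).mul_const b).mul
    (hasDerivAt_star (hW.deriv_right t s))).congr_deriv ?_
  rw [star_neg, star_mul, hK]
  noncomm_ring

/-- Conjugation with `W_{t,s}` as a bounded operator. -/
noncomputable def toCLM (_ : IsUnitaryPropagator K W) (t s : ℝ) : A →L[ℂ] A :=
  (ContinuousLinearMap.mul ℂ A (W t s)) ∘L ((ContinuousLinearMap.mul ℂ A).flip (star (W t s)))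

theorem toCLM_apply (hW : IsUnitaryPropagator K W) (t s : ℝ) (b : A) :
    hW.toCLM t s b = W t s * b * star (W t s) := by
  simp [toCLM, mul_assoc]

end IsUnitaryPropagator

/-- Variation of constants for the equation `g' = [J, g] + R`, with `J` skew-adjoint. -/
theorem norm_le_of_hasDerivAt_commutator {J g R : ℝ → A} (hJ : Continuous J)
    (hJs : ∀ t, star (J t) = -J t) (s t : ℝ)
    (hg : ∀ r, HasDerivAt g (J r * g r - g r * J r + R r) r) {β β' : ℝ → ℝ}
    (hβ : ∀ u, HasDerivAt β (β' u) u) (h0 : ‖g s‖ ≤ β 0)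
    (h : ∀ r, |r - s| ≤ |t - s| → ‖R r‖ ≤ β' |r - s|) : ‖g t‖ ≤ β |t - s| := by
  -- Conjugation with the propagator of $-J$ preserves norms and cancels $[J,g]$, leaving only the
  -- conjugated $R$ as derivative.
  obtain ⟨N, hN, -⟩ := exists_isUnitaryPropagator (K := fun r => -J r) ⊤ isClosed_univ
    hJ.neg (fun r => by rw [star_neg, hJs]) (fun _ => trivial)
  have hd : ∀ r, HasDerivAt (fun r => N r s * g r * star (N r s))
      (N r s * R r * star (N r s)) r := fun r =>
    (hN.hasDerivAt_conj_left (fun r => by rw [star_neg, hJs]) s (hg r)).congr_deriv (by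
      congr 2; noncomm_ring)
  have := norm_le_of_norm_deriv_le s t hd hβ (by rwa [hN.norm_conj])
    (fun r hr => by rw [hN.norm_conj]; exact h r hr)
  rwa [hN.norm_conj] at this

end Propagator

/-! ### Locality in the CAR algebra -/

section Locality

variable {d : ℕ}

/-- The norm closure of the local algebra `𝒰_X`. -/
noncomputable def clAlg (X : Finset (Lattice d)) : StarSubalgebra ℂ (CAR d) :=
  (localAlg X).topologicalClosure

theorem isClosed_clAlg (X : Finset (Lattice d)) : IsClosed (clAlg X : Set (CAR d)) :=
  StarSubalgebra.isClosed_topologicalClosure _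

theorem localAlg_le_clAlg (X : Finset (Lattice d)) : localAlg X ≤ clAlg X :=
  StarSubalgebra.le_topologicalClosure _

theorem localAlg_mono {X Y : Finset (Lattice d)} (h : X ⊆ Y) : localAlg X ≤ localAlg Y :=
  StarAlgebra.adjoin_mono (Set.image_mono (by exact_mod_cast h))

theorem clAlg_mono {X Y : Finset (Lattice d)} (h : X ⊆ Y) : clAlg X ≤ clAlg Y :=
  StarSubalgebra.topologicalClosure_mono (localAlg_mono h)

theorem norm_parity (b : CAR d) : ‖parity d b‖ = ‖b‖ := StarAlgEquiv.norm_map _ b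

theorem norm_translation (z : Lattice d) (b : CAR d) : ‖translation z b‖ = ‖b‖ :=
  StarAlgEquiv.norm_map _ b

theorem continuous_parity : Continuous (parity d) :=
  (AddMonoidHomClass.isometry_of_norm (parity d) norm_parity).continuous

/-- The algebra `𝒰⁺` of even elements. -/
noncomputable def evenSubalgebra (d : ℕ) : StarSubalgebra ℂ (CAR d) where
  carrier := {b | IsEven b}
  mul_mem' {a b} ha hb := by
    simp only [Set.mem_ofPred_eq, IsEven] at ha hb ⊢
    rw [map_mul, ha, hb]
  add_mem' {a b} ha hb := by
    simp only [Set.mem_ofPred_eq, IsEven] at ha hb ⊢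
    rw [map_add, ha, hb]
  algebraMap_mem' r := by
    simp only [Set.mem_ofPred_eq, IsEven, Algebra.algebraMap_eq_smul_one, map_smul, map_one]
  star_mem' {a} ha := by
    simp only [Set.mem_ofPred_eq, IsEven] at ha ⊢
    rw [map_star, ha]

theorem isClosed_evenSubalgebra : IsClosed (evenSubalgebra d : Set (CAR d)) :=
  isClosed_eq continuous_parity continuous_id

/-- The even elements of the closed local algebra of `X`. -/
noncomputable def evenAlg (X : Finset (Lattice d)) : StarSubalgebra ℂ (CAR d) :=
  clAlg X ⊓ evenSubalgebra d

theorem isClosed_evenAlg (X : Finset (Lattice d)) : IsClosed (evenAlg X : Set (CAR d)) :=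
  (isClosed_clAlg X).inter isClosed_evenSubalgebra

theorem evenAlg_mono {X Y : Finset (Lattice d)} (h : X ⊆ Y) : evenAlg X ≤ evenAlg Y :=
  inf_le_inf_right _ (clAlg_mono h)

theorem evenAlg_le_clAlg (X : Finset (Lattice d)) : evenAlg X ≤ clAlg X := inf_le_left

theorem mem_evenAlg {X : Finset (Lattice d)} {b : CAR d} (hb : b ∈ localAlg X) (he : IsEven b) :
    b ∈ evenAlg X :=
  ⟨localAlg_le_clAlg X hb, he⟩

theorem star_ann_mul_ann (x y : Lattice d) (h : x ≠ y) :
    star (ann y) * ann x = -(ann x * star (ann y)) := by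
  have := ann_mul_star_ann x y
  rw [if_neg h] at this
  exact eq_neg_of_add_eq_zero_right this

/-- Moving $a_y$ past a generator at another site costs a sign, which is what parity records. The
relations for $a_y$ and $a_y^*$ are proved together because the induction step for the adjoint
exchanges them. -/
theorem ann_mul_eq_parity_mul {X : Finset (Lattice d)} {y : Lattice d} (hy : y ∉ X) {b : CAR d}
    (hb : b ∈ localAlg X) :
    ann y * b = parity d b * ann y ∧ star (ann y) * b = parity d b * star (ann y) := by
  induction hb using StarAlgebra.adjoin_induction with
  | mem b hb =>
    obtain ⟨x, hx, rfl⟩ := hb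
    have hne : x ≠ y := fun h => hy (h ▸ hx)
    rw [parity_ann]
    constructor
    · rw [neg_mul]; exact eq_neg_of_add_eq_zero_left (ann_mul_ann y x)
    · rw [neg_mul]; exact star_ann_mul_ann x y hne
  | algebraMap r =>
    simp only [Algebra.algebraMap_eq_smul_one, map_smul, map_one]
    simp
  | add a b _ _ ha hb =>
    simp only [map_add, mul_add, add_mul, ha.1, ha.2, hb.1, hb.2, and_self]
  | mul a b _ _ ha hb =>
    constructor
    · rw [← mul_assoc, ha.1, mul_assoc, hb.1, map_mul, mul_assoc]
    · rw [← mul_assoc, ha.2, mul_assoc, hb.2, map_mul, mul_assoc]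
  | star b _ hb =>
    have hp : ∀ c : CAR d, parity d (parity d c) = c := fun c => by
      refine Subtype.ext ?_
      change (parityU d).conjStarAlgEquiv ((parityU d).conjStarAlgEquiv c.1) = c.1
      conv_lhs => enter [1]; rw [← parityU_symm]
      ext; simp
    constructor
    · have := congrArg (fun c => parity d (star c)) hb.2
      simp only [star_mul, star_star, map_mul, parity_ann, map_star, hp] at this
      rw [map_star]
      simpa using this.symm
    · have := congrArg (fun c => parity d (star c)) hb.1
      simp only [star_mul, map_mul, map_star, parity_ann, star_neg, hp] at this
      rw [map_star]
      simpa using this.symm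

theorem commute_ann_of_mem_evenAlg {X : Finset (Lattice d)} {y : Lattice d} (hy : y ∉ X)
    {a : CAR d} (ha : a ∈ evenAlg X) : ann y * a = a * ann y := by
  have hcl : IsClosed {b : CAR d | ann y * b = parity d b * ann y} :=
    isClosed_eq (by fun_prop) (continuous_parity.mul continuous_const)
  have : ann y * a = parity d a * ann y :=
    closure_minimal (fun b hb => (ann_mul_eq_parity_mul hy hb).1) hcl ha.1
  rwa [show parity d a = a from ha.2] at this

/-- Even local elements commute with the elements localized in a disjoint region. -/
theorem commute_of_disjoint {X Y : Finset (Lattice d)} (h : Disjoint X Y) {a b : CAR d}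
    (ha : a ∈ evenAlg X) (hb : b ∈ clAlg Y) : a * b = b * a := by
  -- Evenness removes the sign, so `a` commutes with every generator outside `X`. The same for `star
  -- a` is required by the centralizer of a star algebra.
  have hle : localAlg Y ≤ StarSubalgebra.centralizer ℂ {a} := by
    refine StarAlgebra.adjoin_le ?_
    rintro _ ⟨y, hy, rfl⟩
    have hyX : y ∉ X := fun hX => Finset.disjoint_left.1 h hX hy
    rw [SetLike.mem_coe, StarSubalgebra.mem_centralizer_iff]
    intro g hg
    rw [Set.mem_singleton_iff.1 hg]
    exact ⟨(commute_ann_of_mem_evenAlg hyX ha).symm,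
      (commute_ann_of_mem_evenAlg hyX (star_mem ha)).symm⟩
  have hcl : IsClosed {b : CAR d | a * b = b * a} := isClosed_eq (by fun_prop) (by fun_prop)
  refine closure_minimal (fun c hc => ?_) hcl hb
  exact ((StarSubalgebra.mem_centralizer_iff ℂ).1 (hle hc) a rfl).1

/-- The local algebra of the empty region consists of scalars. No evenness is needed, which settles
the empty-support case of the Lieb–Robinson induction. -/
theorem clAlg_empty_commute {a b : CAR d} (hb : b ∈ clAlg (∅ : Finset (Lattice d))) :
    a * b = b * a := by
  have hle : localAlg (∅ : Finset (Lattice d)) ≤ StarSubalgebra.centralizer ℂ Set.univ :=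
    StarAlgebra.adjoin_le (by simp)
  have hcl : IsClosed {b : CAR d | a * b = b * a} := isClosed_eq (by fun_prop) (by fun_prop)
  refine closure_minimal (fun c hc => ?_) hcl hb
  exact ((StarSubalgebra.mem_centralizer_iff ℂ).1 (hle hc) a trivial).1

theorem translation_mem_localAlg (z : Lattice d) {L : ℝ} {b : CAR d}
    (hb : b ∈ localAlg (box L)) : translation z b ∈ localAlg (boxAt L z) := by
  have hle : localAlg (box L) ≤
      (localAlg (boxAt L z)).comap (translation z : CAR d →⋆ₐ[ℂ] CAR d) := by
    refine StarAlgebra.adjoin_le ?_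
    rintro _ ⟨x, hx, rfl⟩
    change translation z (ann x) ∈ localAlg (boxAt L z)
    rw [translation_ann]
    exact StarAlgebra.subset_adjoin ℂ _ ⟨x + z, Finset.mem_image_of_mem _ hx, rfl⟩
  exact hle hb

theorem parity_translation (z : Lattice d) {X : Finset (Lattice d)} {b : CAR d}
    (hb : b ∈ localAlg X) : parity d (translation z b) = translation z (parity d b) := by
  induction hb using StarAlgebra.adjoin_induction with
  | mem b hb =>
    obtain ⟨x, hx, rfl⟩ := hb
    rw [translation_ann, parity_ann, parity_ann, map_neg, translation_ann]
  | algebraMap r => simp only [Algebra.algebraMap_eq_smul_one, map_smul, map_one]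
  | add a b _ _ ha hb => rw [map_add, map_add, ha, hb, map_add, map_add]
  | mul a b _ _ ha hb => rw [map_mul, map_mul, ha, hb, map_mul, map_mul]
  | star b _ hb => rw [map_star, map_star, hb, map_star, map_star]

theorem translation_mem_evenAlg (z : Lattice d) {L : ℝ} {b : CAR d}
    (hb : b ∈ localAlg (box L)) (he : IsEven b) : translation z b ∈ evenAlg (boxAt L z) := by
  refine mem_evenAlg (translation_mem_localAlg z hb) ?_
  rw [IsEven, parity_translation z hb, he]

theorem exists_mem_localAlg_of_mem_adjoin {b : CAR d}
    (hb : b ∈ StarAlgebra.adjoin ℂ (Set.range (ann (d := d)))) : ∃ X, b ∈ localAlg X := by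
  classical
  induction hb using StarAlgebra.adjoin_induction with
  | mem b hb =>
    obtain ⟨x, rfl⟩ := hb
    exact ⟨{x}, StarAlgebra.subset_adjoin ℂ _ ⟨x, by simp, rfl⟩⟩
  | algebraMap r => exact ⟨∅, algebraMap_mem _ r⟩
  | add a b _ _ ha hb =>
    obtain ⟨X, hX⟩ := ha
    obtain ⟨Y, hY⟩ := hb
    exact ⟨X ∪ Y, add_mem (localAlg_mono Finset.subset_union_left hX)
      (localAlg_mono Finset.subset_union_right hY)⟩
  | mul a b _ _ ha hb =>
    obtain ⟨X, hX⟩ := ha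
    obtain ⟨Y, hY⟩ := hb
    exact ⟨X ∪ Y, mul_mem (localAlg_mono Finset.subset_union_left hX)
      (localAlg_mono Finset.subset_union_right hY)⟩
  | star b _ hb =>
    obtain ⟨X, hX⟩ := hb
    exact ⟨X, star_mem hX⟩

/-- The inclusion of the CAR algebra into the bounded operators on the Fock space. -/
noncomputable def carInclusion (d : ℕ) : CAR d →⋆ₐ[ℂ] (Fock d →L[ℂ] Fock d) :=
  (carSubalgebra d).subtype

/-- Local elements are dense. -/
theorem exists_local_norm_sub_lt (b : CAR d) {ε : ℝ} (hε : 0 < ε) :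
    ∃ X, ∃ c ∈ localAlg X, ‖b - c‖ < ε := by
  have hb : b.1 ∈ closure (StarAlgebra.adjoin ℂ (Set.range (fockA (d := d))) :
      Set (Fock d →L[ℂ] Fock d)) := b.2
  obtain ⟨c, hc, hbc⟩ := Metric.mem_closure_iff.1 hb ε hε
  have hmap : StarAlgebra.adjoin ℂ (Set.range (fockA (d := d))) ≤
      (StarAlgebra.adjoin ℂ (Set.range (ann (d := d)))).map (carInclusion d) := by
    refine StarAlgebra.adjoin_le ?_
    rintro _ ⟨x, rfl⟩
    exact ⟨ann x, StarAlgebra.subset_adjoin ℂ _ ⟨x, rfl⟩, rfl⟩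
  obtain ⟨c', hc', rfl⟩ := hmap hc
  obtain ⟨X, hX⟩ := exists_mem_localAlg_of_mem_adjoin hc'
  refine ⟨X, c', hX, ?_⟩
  rw [dist_eq_norm] at hbc
  exact hbc

end Locality

/-! ### Kernel estimates -/

section Kernel

variable {d : ℕ}

theorem len_neg (x : Lattice d) : len (-x) = len x := by
  unfold len
  rw [← nnnorm_neg]
  congr 1
  ext i
  simp

/-- The kernel `F(|x - y|)`. -/
noncomputable def DecayFunction.kern (F : DecayFunction d) (x y : Lattice d) : ℝ := F.toFun (len (x - y))

theorem DecayFunction.kern_pos (F : DecayFunction d) (x y : Lattice d) : 0 < F.kern x y :=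
  F.pos _

theorem DecayFunction.kern_comm (F : DecayFunction d) (x y : Lattice d) :
    F.kern x y = F.kern y x := by
  rw [kern, kern, ← len_neg, neg_sub]

/-- The total weight `∑_x F(|x|)`. -/
noncomputable def DecayFunction.mass (F : DecayFunction d) : ℝ := ∑' x : Lattice d, F.toFun (len x)

theorem DecayFunction.summable_kern (F : DecayFunction d) (x : Lattice d) :
    Summable (F.kern x) :=
  ((Equiv.subLeft x).summable_iff (f := fun x : Lattice d => F.toFun (len x))).2 F.summable

theorem DecayFunction.sum_kern_le (F : DecayFunction d) (x : Lattice d)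
    (S : Finset (Lattice d)) : ∑ z ∈ S, F.kern x z ≤ F.mass := by
  refine ((F.summable_kern x).sum_le_tsum S fun z _ => (F.kern_pos x z).le).trans_eq ?_
  exact (Equiv.subLeft x).tsum_eq (fun x : Lattice d => F.toFun (len x))

theorem DecayFunction.mass_nonneg (F : DecayFunction d) : 0 ≤ F.mass :=
  tsum_nonneg fun _ => (F.pos _).le

theorem DecayFunction.sum_kern_mul_kern_le (F : DecayFunction d) (x y : Lattice d)
    (S : Finset (Lattice d)) : ∑ z ∈ S, F.kern x z * F.kern z y ≤ F.D * F.kern x y := by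
  have h1 : ∑ z ∈ S, ENNReal.ofReal (F.kern x z * F.kern z y / F.kern x y) ≤
      convConst d F.toFun :=
    (ENNReal.sum_le_tsum S).trans (le_iSup_of_le x (le_iSup_of_le y le_rfl))
  rw [← ENNReal.ofReal_sum_of_nonneg (fun z _ => div_nonneg
    (mul_pos (F.kern_pos _ _) (F.kern_pos _ _)).le (F.kern_pos _ _).le)] at h1
  have h2 := (ENNReal.ofReal_le_iff_le_toReal F.convConst_lt_top.ne).1 h1
  rwa [← Finset.sum_div, div_le_iff₀ (F.kern_pos x y)] at h2

/-- The single term $x=y=z=0$ of the convolution bound gives $\mathbf F(0) \le \mathbf D$.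
Positivity matters because `growth` divides by $\mathbf D$. -/
theorem DecayFunction.D_pos (F : DecayFunction d) : 0 < F.D := by
  have := F.sum_kern_mul_kern_le 0 0 {0}
  rw [Finset.sum_singleton] at this
  exact (F.kern_pos 0 0).trans_le (le_of_mul_le_mul_right this (F.kern_pos 0 0))

theorem sum_norm_le {F : DecayFunction d} {Ψ : ℝ → Interaction d} (hΨ : supNormW Ψ F < ⊤)
    (t : ℝ) (x y : Lattice d) (𝒵 : Finset (Finset (Lattice d)))
    (h𝒵 : ∀ Z ∈ 𝒵, x ∈ Z ∧ y ∈ Z) :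
    ∑ Z ∈ 𝒵, ‖(Ψ t).toFun Z‖ ≤ (supNormW Ψ F).toReal * F.kern x y := by
  have h1 : ∑ Z ∈ 𝒵, ENNReal.ofReal (‖(Ψ t).toFun Z‖ / F.kern x y) ≤ supNormW Ψ F := by
    rw [← Finset.sum_coe_sort]
    refine le_trans ?_ (le_iSup_of_le t (le_iSup_of_le x (le_iSup_of_le y le_rfl)))
    refine le_trans (le_of_eq ?_) (ENNReal.sum_le_tsum (Finset.univ.map
      ⟨fun Z : 𝒵 => (⟨Z.1, h𝒵 Z.1 Z.2⟩ : {Λ : Finset (Lattice d) // x ∈ Λ ∧ y ∈ Λ}),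
        fun Z Z' h => Subtype.ext (congrArg (fun u => u.1) h)⟩))
    rw [Finset.sum_map]
    rfl
  rw [← ENNReal.ofReal_sum_of_nonneg (fun z _ => div_nonneg (norm_nonneg _)
    (F.kern_pos _ _).le)] at h1
  have h2 := (ENNReal.ofReal_le_iff_le_toReal hΨ.ne).1 h1
  rwa [← Finset.sum_div, div_le_iff₀ (F.kern_pos x y)] at h2

/-- Summation over the interaction terms that meet `X`. -/
theorem sum_norm_mul_sum_le {F : DecayFunction d} {Ψ : ℝ → Interaction d}
    (hΨ : supNormW Ψ F < ⊤) (t : ℝ) (X Λ : Finset (Lattice d))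
    (𝒵 : Finset (Finset (Lattice d))) (hΛ : ∀ Z ∈ 𝒵, Z ⊆ Λ) (hX : ∀ Z ∈ 𝒵, ¬ Disjoint Z X)
    (g : Lattice d → ℝ) (hg : ∀ z, 0 ≤ g z) :
    ∑ Z ∈ 𝒵, ‖(Ψ t).toFun Z‖ * ∑ z ∈ Z, g z ≤
      (supNormW Ψ F).toReal * ∑ x ∈ X, ∑ z ∈ Λ, F.kern x z * g z := by
  calc ∑ Z ∈ 𝒵, ‖(Ψ t).toFun Z‖ * ∑ z ∈ Z, g z
      ≤ ∑ Z ∈ 𝒵, ∑ x ∈ X, ∑ z ∈ Λ, if x ∈ Z ∧ z ∈ Z then ‖(Ψ t).toFun Z‖ * g z else 0 := by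
        refine Finset.sum_le_sum fun Z hZ => ?_
        -- One common site is enough: the sum over all of `X` only overcounts by non-negative terms,
        -- and it lets the norm of the interaction be applied to each pair $(x,z)$.
        obtain ⟨x, hxZ, hxX⟩ := Finset.not_disjoint_iff.1 (hX Z hZ)
        have hnn : ∀ x ∈ X, 0 ≤ ∑ z ∈ Λ, if x ∈ Z ∧ z ∈ Z then ‖(Ψ t).toFun Z‖ * g z else 0 :=
          fun x _ => Finset.sum_nonneg fun z _ => by
            split_ifs
            · exact mul_nonneg (norm_nonneg _) (hg z)
            · exact le_rfl
        refine le_trans (le_of_eq ?_) (Finset.single_le_sum hnn hxX)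
        simp only [hxZ, true_and]
        rw [← Finset.sum_filter, Finset.filter_mem_eq_inter, Finset.inter_eq_right.2 (hΛ Z hZ),
          Finset.mul_sum]
    _ = ∑ x ∈ X, ∑ z ∈ Λ, (∑ Z ∈ 𝒵 with x ∈ Z ∧ z ∈ Z, ‖(Ψ t).toFun Z‖) * g z := by
        rw [Finset.sum_comm]
        refine Finset.sum_congr rfl fun x _ => ?_
        rw [Finset.sum_comm]
        refine Finset.sum_congr rfl fun z _ => ?_
        rw [← Finset.sum_filter, Finset.sum_mul]
    _ ≤ ∑ x ∈ X, ∑ z ∈ Λ, ((supNormW Ψ F).toReal * F.kern x z) * g z := by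
        refine Finset.sum_le_sum fun x _ => Finset.sum_le_sum fun z _ => ?_
        exact mul_le_mul_of_nonneg_right
          (sum_norm_le hΨ t x z _ fun Z hZ => (Finset.mem_filter.1 hZ).2) (hg z)
    _ = _ := by simp only [Finset.mul_sum, mul_assoc]

/-- The kernel `δ_{x,y} + e F(|x - y|)`. -/
noncomputable def DecayFunction.lrKern (F : DecayFunction d) (e : ℝ) (x y : Lattice d) : ℝ :=
  (if x = y then 1 else 0) + e * F.kern x y

theorem DecayFunction.lrKern_nonneg (F : DecayFunction d) {e : ℝ} (he : 0 ≤ e)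
    (x y : Lattice d) : 0 ≤ F.lrKern e x y := by
  unfold lrKern
  have := mul_nonneg he (F.kern_pos x y).le
  split_ifs <;> linarith

theorem DecayFunction.lrKern_comm (F : DecayFunction d) (e : ℝ) (x y : Lattice d) :
    F.lrKern e x y = F.lrKern e y x := by
  simp only [lrKern, F.kern_comm x y, eq_comm]

/-- The diagonal part of the kernel reproduces $\mathbf F$ and the other part costs a factor
$\mathbf D$. One step of the Lieb–Robinson iteration therefore gives a multiple of $\mathbf F$
again. -/
theorem DecayFunction.sum_kern_mul_lrKern_le (F : DecayFunction d) {e : ℝ} (he : 0 ≤ e)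
    (x y : Lattice d) (S : Finset (Lattice d)) :
    ∑ z ∈ S, F.kern x z * F.lrKern e z y ≤ (1 + F.D * e) * F.kern x y := by
  have h1 : ∑ z ∈ S, F.kern x z * (if z = y then 1 else 0) ≤ F.kern x y := by
    simp only [mul_ite, mul_one, mul_zero, Finset.sum_ite_eq']
    split_ifs
    · exact le_rfl
    · exact (F.kern_pos x y).le
  have h2 := mul_le_mul_of_nonneg_left (F.sum_kern_mul_kern_le x y S) he
  have h3 : ∑ z ∈ S, F.kern x z * F.lrKern e z y =
      ∑ z ∈ S, F.kern x z * (if z = y then 1 else 0) +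
        e * ∑ z ∈ S, F.kern x z * F.kern z y := by
    rw [Finset.mul_sum, ← Finset.sum_add_distrib]
    refine Finset.sum_congr rfl fun z _ => ?_
    rw [lrKern]
    ring
  rw [h3]
  linarith

/-- The function `(e^{2 D α u} - 1) / D`. -/
noncomputable def DecayFunction.growth (F : DecayFunction d) (α u : ℝ) : ℝ :=
  (Real.exp (2 * F.D * α * u) - 1) / F.D

theorem DecayFunction.one_add_D_mul_growth (F : DecayFunction d) (α u : ℝ) :
    1 + F.D * F.growth α u = Real.exp (2 * F.D * α * u) := by
  rw [growth, mul_div_cancel₀ _ F.D_pos.ne']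
  ring

theorem DecayFunction.growth_nonneg (F : DecayFunction d) {α u : ℝ} (hα : 0 ≤ α) (hu : 0 ≤ u) :
    0 ≤ F.growth α u := by
  have := F.D_pos
  refine div_nonneg (sub_nonneg.2 (Real.one_le_exp (by positivity))) this.le

/-- The function `growth` is chosen to solve $e' = 2\alpha(1+\mathbf D e)$, $e(0)=0$. With this
choice $\delta + e\mathbf F$ is reproduced, as an upper bound, by the Lieb–Robinson integral
inequality, and no series has to be summed. -/
theorem DecayFunction.hasDerivAt_growth (F : DecayFunction d) (α u : ℝ) :
    HasDerivAt (F.growth α) (2 * α * (1 + F.D * F.growth α u)) u := by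
  have h1 : HasDerivAt (fun u : ℝ => 2 * F.D * α * u) (2 * F.D * α) u := by
    simpa using (hasDerivAt_id u).const_mul (2 * F.D * α)
  refine ((h1.exp.sub_const 1).div_const F.D).congr_deriv ?_
  rw [one_add_D_mul_growth]
  have := F.D_pos.ne'
  field_simp

end Kernel

/-! ### Finite-volume Hamiltonians -/

section Hamiltonian

variable {d : ℕ}

/-- The Hamiltonian `∑_{Z ⊆ Λ} Φ_Z + ∑_{x ∈ Λ} V_x`. -/
noncomputable def ham (Φ : Interaction d) (V : Potential d) (Λ : Finset (Lattice d)) : CAR d :=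
  ∑ Z ∈ Λ.powerset, Φ.toFun Z + ∑ x ∈ Λ, V.toFun x

theorem Interaction.mem_evenAlg (Φ : Interaction d) {Z Λ : Finset (Lattice d)} (h : Z ⊆ Λ) :
    Φ.toFun Z ∈ evenAlg Λ :=
  evenAlg_mono h (FermiLattice.mem_evenAlg (Φ.mem_localAlg Z) (Φ.isEven Z))

theorem Potential.mem_evenAlg (V : Potential d) {x : Lattice d} {Λ : Finset (Lattice d)}
    (h : x ∈ Λ) : V.toFun x ∈ evenAlg Λ :=
  evenAlg_mono (Finset.singleton_subset_iff.2 h)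
    (FermiLattice.mem_evenAlg (V.mem_localAlg x) (V.isEven x))

theorem ham_mem_evenAlg (Φ : Interaction d) (V : Potential d) (Λ : Finset (Lattice d)) :
    ham Φ V Λ ∈ evenAlg Λ :=
  add_mem (sum_mem fun _ hZ => Φ.mem_evenAlg (Finset.mem_powerset.1 hZ))
    (sum_mem fun _ hx => V.mem_evenAlg hx)

theorem star_I_smul {a : CAR d} (ha : IsSelfAdjoint a) :
    star (Complex.I • a) = -(Complex.I • a) := by
  rw [star_smul, ha.star_eq, Complex.star_def, Complex.conj_I, neg_smul]

theorem isSelfAdjoint_ham (Φ : Interaction d) (V : Potential d) (Λ : Finset (Lattice d)) :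
    IsSelfAdjoint (ham Φ V Λ) :=
  (isSelfAdjoint_sum _ fun _ _ => Φ.isSelfAdjoint _).add
    (isSelfAdjoint_sum _ fun _ _ => V.isSelfAdjoint _)

theorem norm_commutator_le {A : Type*} [NormedRing A] (a b : A) :
    ‖a * b - b * a‖ ≤ 2 * ‖a‖ * ‖b‖ := by
  refine (norm_sub_le _ _).trans ?_
  have h1 := norm_mul_le a b
  have h2 := norm_mul_le b a
  linarith

/-- Only the terms that meet `X` contribute to the commutator of a Hamiltonian with an element
localized in `X`. -/
theorem commutator_ham (Φ : Interaction d) (V : Potential d) (Λ X : Finset (Lattice d)) {b : CAR d}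
    (hb : b ∈ clAlg X) :
    ham Φ V Λ * b - b * ham Φ V Λ =
      ((∑ Z ∈ Λ.powerset with ¬ Disjoint Z X, Φ.toFun Z) * b -
        b * ∑ Z ∈ Λ.powerset with ¬ Disjoint Z X, Φ.toFun Z) +
      ((∑ x ∈ Λ ∩ X, V.toFun x) * b - b * ∑ x ∈ Λ ∩ X, V.toFun x) := by
  have h1 : ∀ 𝒵 : Finset (Finset (Lattice d)), (∑ Z ∈ 𝒵, Φ.toFun Z) * b - b * ∑ Z ∈ 𝒵, Φ.toFun Z
      = ∑ Z ∈ 𝒵, (Φ.toFun Z * b - b * Φ.toFun Z) := fun 𝒵 => by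
    rw [Finset.sum_mul, Finset.mul_sum, Finset.sum_sub_distrib]
  have h2 : ∀ S : Finset (Lattice d), (∑ x ∈ S, V.toFun x) * b - b * ∑ x ∈ S, V.toFun x
      = ∑ x ∈ S, (V.toFun x * b - b * V.toFun x) := fun 𝒵 => by
    rw [Finset.sum_mul, Finset.mul_sum, Finset.sum_sub_distrib]
  rw [h1, h2, Finset.sum_filter_of_ne, Finset.sum_subset Finset.inter_subset_left, ← h1, ← h2, ham]
  · noncomm_ring
  · intro x hxΛ hx
    refine sub_eq_zero.2 (commute_of_disjoint (X := {x}) ?_ (V.mem_evenAlg (by simp)) hb)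
    refine Finset.disjoint_singleton_left.2 fun hX => hx (Finset.mem_inter.2 ⟨hxΛ, hX⟩)
  · intro Z _ hne hdis
    exact hne (sub_eq_zero.2 (commute_of_disjoint hdis (Φ.mem_evenAlg subset_rfl) hb))

end Hamiltonian

/-! ### Lieb–Robinson bounds in finite volume -/

section LiebRobinson

variable {d : ℕ} {F : DecayFunction d} {Ψ : ℝ → Interaction d} {V : ℝ → Potential d}

theorem continuous_ham (hΨc : ∀ Λ, Continuous fun t => (Ψ t).toFun Λ)
    (hVc : ∀ y, Continuous fun t => (V t).toFun y) (Λ : Finset (Lattice d)) :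
    Continuous fun t => ham (Ψ t) (V t) Λ :=
  (continuous_finsetSum _ fun Z _ => hΨc Z).add (continuous_finsetSum _ fun x _ => hVc x)

/-- The unitary propagators of the finite-volume dynamics. -/
abbrev IsHamPropagator (Ψ : ℝ → Interaction d) (V : ℝ → Potential d) (Λ : Finset (Lattice d))
    (W : ℝ → ℝ → CAR d) : Prop :=
  IsUnitaryPropagator (fun t => Complex.I • ham (Ψ t) (V t) Λ) W

theorem star_I_smul_ham (Ψ : ℝ → Interaction d) (V : ℝ → Potential d) (Λ : Finset (Lattice d))
    (t : ℝ) : star (Complex.I • ham (Ψ t) (V t) Λ) = -(Complex.I • ham (Ψ t) (V t) Λ) :=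
  star_I_smul (isSelfAdjoint_ham _ _ _)

/-- Control of `[τ_{t,s}(B), A]` by the commutators `[τ_{r,s}(Ψ_Z), A]`, where `Z` meets the
support of `B`. -/
theorem norm_commutator_conj_le (hΨc : ∀ Λ, Continuous fun t => (Ψ t).toFun Λ)
    (hVc : ∀ y, Continuous fun t => (V t).toFun y) {Λ X : Finset (Lattice d)}
    {W : ℝ → ℝ → CAR d} (hW : IsHamPropagator Ψ V Λ W) {A B : CAR d} (hB : B ∈ clAlg X) (s t : ℝ)
    {β β' : ℝ → ℝ} (hβ : ∀ u, HasDerivAt β (β' u) u)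
    (h0 : ∀ b ∈ clAlg X, ‖b‖ = ‖B‖ → ‖b * A - A * b‖ ≤ β 0)
    (h : ∀ r, 2 * ‖B‖ * ∑ Z ∈ Λ.powerset with ¬ Disjoint Z X,
      ‖W r s * (Ψ r).toFun Z * star (W r s) * A - A * (W r s * (Ψ r).toFun Z * star (W r s))‖ ≤
        β' |r - s|) :
    ‖W t s * B * star (W t s) * A - A * (W t s * B * star (W t s))‖ ≤ β |t - s| := by
  have hVs : ∀ r, star (Complex.I • ∑ x ∈ Λ ∩ X, (V r).toFun x) =
      -(Complex.I • ∑ x ∈ Λ ∩ X, (V r).toFun x) := fun r =>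
    star_I_smul (isSelfAdjoint_sum _ fun _ _ => (V r).isSelfAdjoint _)
  -- Interaction picture: the on-site terms in `X` generate a dynamics `S` that keeps elements of
  -- `clAlg X` localized in `X`. Running it backwards cancels these terms, so no bound on the
  -- potential enters.
  obtain ⟨S, hS, hSX⟩ := exists_isUnitaryPropagator (K := fun r => Complex.I •
      ∑ x ∈ Λ ∩ X, (V r).toFun x) (clAlg X) (isClosed_clAlg X)
    ((continuous_finsetSum _ fun x _ => hVc x).fun_const_smul _) hVs
    (fun r => (clAlg X).smul_mem (sum_mem fun x hx => evenAlg_le_clAlg X ((V r).mem_evenAlg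
      (Finset.mem_inter.1 hx).2)) _)
  set b : ℝ → CAR d := fun r => S t r * B * star (S t r) with hb
  have hbX : ∀ r, b r ∈ clAlg X := fun r =>
    mul_mem (mul_mem (hSX t r) hB) (star_mem (hSX t r))
  have hbn : ∀ r, ‖b r‖ = ‖B‖ := fun r => hS.norm_conj t r B
  have hbd := hS.hasDerivAt_conj_right hVs B t
  set J₀ : ℝ → CAR d := fun r => ∑ Z ∈ Λ.powerset with ¬ Disjoint Z X, (Ψ r).toFun Z with hJ₀
  set J : ℝ → CAR d := fun r => W r s * (Complex.I • J₀ r) * star (W r s) with hJ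
  -- This path ends at $\tau_{t,s}(B)$ for $r=t$. It starts for $r=s$ at an element of `clAlg X`
  -- with the norm of `B`, hence the form of the hypothesis `h0`.
  set c : ℝ → CAR d := fun r => W r s * b r * star (W r s) with hc
  have hcn : ∀ r, ‖c r‖ = ‖B‖ := fun r => by rw [hc]; exact (hW.norm_conj r s _).trans (hbn r)
  have hWc : Continuous fun r => W r s :=
    continuous_iff_continuousAt.2 fun r => (hW.deriv_left r s).continuousAt
  have hJc : Continuous J := by
    have : Continuous J₀ := continuous_finsetSum _ fun Z _ => hΨc Z
    fun_prop
  have hJ₀s : ∀ r, IsSelfAdjoint (J₀ r) := fun r =>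
    isSelfAdjoint_sum _ fun _ _ => (Ψ r).isSelfAdjoint _
  have hJs : ∀ r, star (J r) = -J r := fun r => by
    rw [hJ]
    simp only [star_mul, star_star, star_I_smul (hJ₀s r)]
    noncomm_ring
  have hcd : ∀ r, HasDerivAt c (J r * c r - c r * J r) r := fun r => by
    refine (hW.hasDerivAt_conj_left (star_I_smul_ham Ψ V Λ) s (hbd r)).congr_deriv ?_
    have h1 := commutator_ham (Ψ r) (V r) Λ X (hbX r)
    have h2 : -(Complex.I • (∑ x ∈ Λ ∩ X, (V r).toFun x) * b r -
          b r * Complex.I • (∑ x ∈ Λ ∩ X, (V r).toFun x)) +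
        (Complex.I • ham (Ψ r) (V r) Λ * b r - b r * Complex.I • ham (Ψ r) (V r) Λ) =
        (Complex.I • J₀ r) * b r - b r * (Complex.I • J₀ r) := by
      simp only [smul_mul_assoc, mul_smul_comm, ← smul_sub, h1]
      rw [smul_add]
      abel
    rw [h2, mul_sub, sub_mul, hW.conj_mul r s _ (b r), hW.conj_mul r s (b r)]
  -- Jacobi identity: $[[J,c],A] = [J,[c,A]] - [c,[J,A]]$. The first term does not change the norm,
  -- and the second contains only the evolved interaction terms that meet `X`.
  have hg : ∀ r, HasDerivAt (fun r => c r * A - A * c r)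
      (J r * (c r * A - A * c r) - (c r * A - A * c r) * J r +
        -(c r * (J r * A - A * J r) - (J r * A - A * J r) * c r)) r := fun r =>
    (((hcd r).mul_const A).sub ((hcd r).const_mul A)).congr_deriv (by noncomm_ring)
  have key := norm_le_of_hasDerivAt_commutator hJc hJs s t hg hβ ?_ ?_
  · have hct : c t = W t s * B * star (W t s) := by
      rw [hc, hb]
      simp [hS.diag]
    rw [← hct]
    exact key
  · have hcs : c s = b s := by
      rw [hc]
      simp [hW.diag]
    change ‖c s * A - A * c s‖ ≤ β 0
    rw [hcs]
    exact h0 _ (hbX s) (hbn s)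
  · intro r _
    refine le_trans ?_ (h r)
    rw [norm_neg]
    refine (norm_commutator_le _ _).trans ?_
    rw [hcn]
    refine mul_le_mul_of_nonneg_left ?_ (by positivity)
    have hJA : J r * A - A * J r = Complex.I • ∑ Z ∈ Λ.powerset with ¬ Disjoint Z X,
        (W r s * (Ψ r).toFun Z * star (W r s) * A -
          A * (W r s * (Ψ r).toFun Z * star (W r s))) := by
      rw [hJ]
      simp only [hJ₀, mul_smul_comm, smul_mul_assoc, Finset.mul_sum, Finset.sum_mul,
        Finset.sum_sub_distrib, smul_sub]
    rw [hJA, norm_smul, Complex.norm_I, one_mul]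
    exact norm_sum_le _ _

/-- Picard iteration with the limiting kernel built in from the start. The case $N=0$ is the trivial
bound $2\|A\|\|B\|$. Each further step inserts the bound for the interaction terms into the
derivative estimate: it reproduces the kernel part and turns the error into the next term of an
exponential series, which tends to zero. -/
theorem norm_commutator_conj_le_add_remainder (hΨ : supNormW Ψ F < ⊤)
    (hΨc : ∀ Λ, Continuous fun t => (Ψ t).toFun Λ)
    (hVc : ∀ y, Continuous fun t => (V t).toFun y) {Λ Y : Finset (Lattice d)}
    {W : ℝ → ℝ → CAR d} (hW : IsHamPropagator Ψ V Λ W) {A : CAR d} (hA : A ∈ evenAlg Y) (s : ℝ)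
    (N : ℕ) (X : Finset (Lattice d)) (B : CAR d) (hB : B ∈ clAlg X) (t : ℝ) :
    ‖W t s * B * star (W t s) * A - A * (W t s * B * star (W t s))‖ ≤
      2 * ‖A‖ * ‖B‖ * ∑ x ∈ X,
        (∑ y ∈ Y, F.lrKern (F.growth (supNormW Ψ F).toReal |t - s|) x y +
          (2 * (supNormW Ψ F).toReal * F.mass * |t - s|) ^ N / N.factorial) := by
  set α := (supNormW Ψ F).toReal with hα
  have hα0 : 0 ≤ α := ENNReal.toReal_nonneg
  have hm0 := F.mass_nonneg
  have hgr : ∀ u : ℝ, 0 ≤ F.growth α |u| := fun u => F.growth_nonneg hα0 (abs_nonneg u)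
  induction N generalizing X B t with
  | zero =>
    rcases X.eq_empty_or_nonempty with rfl | hX
    · have hWB : W t s * B * star (W t s) = B := by
        rw [clAlg_empty_commute hB, mul_assoc, hW.mul_star_self, mul_one]
      rw [hWB, sub_eq_zero.2 (clAlg_empty_commute hB).symm]
      simp
    · refine (norm_commutator_le _ _).trans ?_
      rw [hW.norm_conj, mul_right_comm]
      refine le_mul_of_one_le_right (by positivity) ?_
      obtain ⟨x, hx⟩ := hX
      refine le_trans ?_ (Finset.single_le_sum (fun x _ => ?_) hx)
      · simpa using Finset.sum_nonneg fun y _ => F.lrKern_nonneg (hgr _) x y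
      · exact add_nonneg (Finset.sum_nonneg fun y _ => F.lrKern_nonneg (hgr _) x y) (by positivity)
  | succ N ih =>
    set β : ℝ → ℝ := fun u => 2 * ‖A‖ * ‖B‖ * ∑ x ∈ X,
        (∑ y ∈ Y, F.lrKern (F.growth α u) x y +
          (2 * α * F.mass * u) ^ (N + 1) / (N + 1).factorial) with hβ
    have hβd : ∀ u, HasDerivAt β (2 * ‖A‖ * ‖B‖ * ∑ x ∈ X,
        (∑ y ∈ Y, 2 * α * (1 + F.D * F.growth α u) * F.kern x y +
          2 * α * F.mass * ((2 * α * F.mass * u) ^ N / N.factorial))) u := fun u => by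
      refine (HasDerivAt.fun_sum fun x _ => HasDerivAt.add (HasDerivAt.fun_sum fun y _ => ?_)
        ?_).const_mul _
      · exact ((F.hasDerivAt_growth α u).mul_const _).const_add _
      · have h1 : HasDerivAt (fun u : ℝ => 2 * α * F.mass * u) (2 * α * F.mass) u := by
          simpa using (hasDerivAt_id u).const_mul (2 * α * F.mass)
        refine ((h1.pow (N + 1)).div_const ((N + 1).factorial : ℝ)).congr_deriv ?_
        rw [Nat.factorial_succ]
        have : (N.factorial : ℝ) ≠ 0 := by positivity
        push_cast
        field_simp
    refine norm_commutator_conj_le hΨc hVc hW hB s t hβd (fun b hb hbn => ?_) (fun r => ?_)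
    · have hnn : 0 ≤ β 0 := by
        refine mul_nonneg (by positivity) (Finset.sum_nonneg fun x _ => add_nonneg
          (Finset.sum_nonneg fun y _ => F.lrKern_nonneg ?_ x y) (by positivity))
        exact F.growth_nonneg hα0 le_rfl
      -- At time `s` the commutator vanishes for disjoint supports. Otherwise a common site
      -- contributes $1$ through the diagonal of the kernel, and the trivial bound suffices.
      by_cases hd : Disjoint X Y
      · rw [sub_eq_zero.2 (commute_of_disjoint hd.symm hA hb).symm]
        simpa using hnn
      · refine (norm_commutator_le _ _).trans ?_
        rw [hbn, mul_right_comm]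
        refine le_mul_of_one_le_right (by positivity) ?_
        obtain ⟨x, hx, hy⟩ := Finset.not_disjoint_iff.1 hd
        have hk : ∀ x y, 0 ≤ F.lrKern (F.growth α 0) x y :=
          F.lrKern_nonneg (F.growth_nonneg hα0 le_rfl)
        refine le_trans ?_ (Finset.single_le_sum (fun x _ => ?_) hx)
        · refine le_trans ?_ (le_add_of_nonneg_right (by positivity))
          refine le_trans ?_ (Finset.single_le_sum (fun y _ => hk x y) hy)
          simp [DecayFunction.lrKern, DecayFunction.growth]
        · exact add_nonneg (Finset.sum_nonneg fun y _ => hk x y) (by positivity)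
    · set g : Lattice d → ℝ := fun z => ∑ y ∈ Y, F.lrKern (F.growth α |r - s|) z y +
          (2 * α * F.mass * |r - s|) ^ N / N.factorial with hg
      have hg0 : ∀ z, 0 ≤ g z := fun z => add_nonneg
        (Finset.sum_nonneg fun y _ => F.lrKern_nonneg (hgr _) z y) (by positivity)
      -- The induction hypothesis is used with the interaction term as observable and `Z` as its
      -- support; this is why support, observable and time are generalized in the induction.
      calc _ ≤ 2 * ‖B‖ * ∑ Z ∈ Λ.powerset with ¬ Disjoint Z X,
              2 * ‖A‖ * ‖(Ψ r).toFun Z‖ * ∑ z ∈ Z, g z := by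
            refine mul_le_mul_of_nonneg_left (Finset.sum_le_sum fun Z _ => ?_) (by positivity)
            exact ih Z _ (evenAlg_le_clAlg Z ((Ψ r).mem_evenAlg subset_rfl)) r
        _ = 2 * ‖B‖ * (2 * ‖A‖) * ∑ Z ∈ Λ.powerset with ¬ Disjoint Z X,
              ‖(Ψ r).toFun Z‖ * ∑ z ∈ Z, g z := by
            simp only [Finset.mul_sum, mul_assoc]
        _ ≤ 2 * ‖B‖ * (2 * ‖A‖) * (α * ∑ x ∈ X, ∑ z ∈ Λ, F.kern x z * g z) := by
            refine mul_le_mul_of_nonneg_left ?_ (by positivity)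
            exact sum_norm_mul_sum_le hΨ r X Λ _
              (fun Z hZ => Finset.mem_powerset.1 (Finset.mem_filter.1 hZ).1)
              (fun Z hZ => (Finset.mem_filter.1 hZ).2) g hg0
        _ ≤ 2 * ‖B‖ * (2 * ‖A‖) * (α * ∑ x ∈ X,
              (∑ y ∈ Y, (1 + F.D * F.growth α |r - s|) * F.kern x y +
                F.mass * ((2 * α * F.mass * |r - s|) ^ N / N.factorial))) := by
            refine mul_le_mul_of_nonneg_left (mul_le_mul_of_nonneg_left
              (Finset.sum_le_sum fun x _ => ?_) hα0) (by positivity)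
            simp only [hg, mul_add, Finset.sum_add_distrib]
            refine add_le_add ?_ ?_
            · simp only [Finset.mul_sum]
              rw [Finset.sum_comm]
              exact Finset.sum_le_sum fun y _ => F.sum_kern_mul_lrKern_le (hgr _) x y Λ
            · rw [← Finset.sum_mul]
              exact mul_le_mul_of_nonneg_right (F.sum_kern_le x Λ) (by positivity)
        _ = _ := by
            simp only [mul_assoc, ← Finset.mul_sum, ← mul_add]
            ring

/-- Lieb–Robinson bound for the finite-volume dynamics in `Λ`. -/
theorem norm_commutator_conj_le_lrKern (hΨ : supNormW Ψ F < ⊤)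
    (hΨc : ∀ Λ, Continuous fun t => (Ψ t).toFun Λ)
    (hVc : ∀ y, Continuous fun t => (V t).toFun y) {Λ X Y : Finset (Lattice d)}
    {W : ℝ → ℝ → CAR d} (hW : IsHamPropagator Ψ V Λ W) {A B : CAR d} (hA : A ∈ evenAlg Y)
    (hB : B ∈ clAlg X) (t s : ℝ) :
    ‖W t s * B * star (W t s) * A - A * (W t s * B * star (W t s))‖ ≤
      2 * ‖A‖ * ‖B‖ * ∑ x ∈ X,
        ∑ y ∈ Y, F.lrKern (F.growth (supNormW Ψ F).toReal |t - s|) x y := by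
  have hlim : Filter.Tendsto (fun N : ℕ => 2 * ‖A‖ * ‖B‖ * ∑ x ∈ X,
        (∑ y ∈ Y, F.lrKern (F.growth (supNormW Ψ F).toReal |t - s|) x y +
          (2 * (supNormW Ψ F).toReal * F.mass * |t - s|) ^ N / N.factorial)) Filter.atTop
      (nhds (2 * ‖A‖ * ‖B‖ * ∑ x ∈ X,
        (∑ y ∈ Y, F.lrKern (F.growth (supNormW Ψ F).toReal |t - s|) x y + 0))) :=
    (tendsto_finsetSum _ fun x _ =>
      (FloorSemiring.tendsto_pow_div_factorial_atTop _).const_add _).const_mul _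
  simp only [add_zero] at hlim
  exact ge_of_tendsto' hlim fun N =>
    norm_commutator_conj_le_add_remainder hΨ hΨc hVc hW hA s N X B hB t

/-- Dependence of the finite-volume dynamics on the volume. -/
theorem norm_conj_sub_conj_le (hΨ : supNormW Ψ F < ⊤)
    (hΨc : ∀ Λ, Continuous fun t => (Ψ t).toFun Λ)
    (hVc : ∀ y, Continuous fun t => (V t).toFun y) {Λ Λ' X : Finset (Lattice d)}
    (hΛ : Λ ⊆ Λ') (hX : X ⊆ Λ) {W W' : ℝ → ℝ → CAR d} (hW : IsHamPropagator Ψ V Λ W)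
    (hWΛ : ∀ t s, W t s ∈ evenAlg Λ) (hW' : IsHamPropagator Ψ V Λ' W') {B : CAR d}
    (hB : B ∈ clAlg X) (t s : ℝ) :
    ‖W' t s * B * star (W' t s) - W t s * B * star (W t s)‖ ≤
      2 * (supNormW Ψ F).toReal * ‖B‖ * Real.exp (2 * F.D * (supNormW Ψ F).toReal * |t - s|) *
        (∑ x ∈ X, ∑ y ∈ Λ' \ Λ, F.kern x y) * |t - s| := by
  set α := (supNormW Ψ F).toReal with hα
  have hα0 : 0 ≤ α := ENNReal.toReal_nonneg
  -- Interpolation between volumes: $r \mapsto \tau'_{r,s}(\tau_{t,r}(B))$ joins $\tau_{t,s}(B)$ at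
  -- $r=s$ to $\tau'_{t,s}(B)$ at $r=t$, and its derivative sees only the difference of the two
  -- Hamiltonians.
  set b : ℝ → CAR d := fun r => W t r * B * star (W t r) with hb
  have hbΛ : ∀ r, b r ∈ clAlg Λ := fun r => mul_mem (mul_mem (evenAlg_le_clAlg Λ (hWΛ t r))
    (clAlg_mono hX hB)) (star_mem (evenAlg_le_clAlg Λ (hWΛ t r)))
  set 𝒵 := Λ'.powerset.filter fun Z => ¬ Z ⊆ Λ with h𝒵
  have hcd : ∀ r, HasDerivAt (fun r => W' r s * b r * star (W' r s))
      (W' r s * (Complex.I • ∑ Z ∈ 𝒵, ((Ψ r).toFun Z * b r - b r * (Ψ r).toFun Z)) *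
        star (W' r s)) r := fun r => by
    refine (hW'.hasDerivAt_conj_left (star_I_smul_ham Ψ V Λ') s
      (hW.hasDerivAt_conj_right (star_I_smul_ham Ψ V Λ) B t r)).congr_deriv ?_
    have h1 : ham (Ψ r) (V r) Λ' = ham (Ψ r) (V r) Λ + ∑ Z ∈ 𝒵, (Ψ r).toFun Z +
        ∑ x ∈ Λ' \ Λ, (V r).toFun x := by
      have e1 : Λ'.powerset.filter (fun Z => Z ⊆ Λ) = Λ.powerset := by
        ext Z
        simp only [Finset.mem_filter, Finset.mem_powerset]
        exact ⟨fun h => h.2, fun h => ⟨h.trans hΛ, h⟩⟩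
      rw [ham, ham, ← Finset.sum_filter_add_sum_filter_not Λ'.powerset (fun Z => Z ⊆ Λ), e1,
        ← Finset.sum_sdiff hΛ]
      abel
    -- The extra potentials commute with `b r`, which stays localized in `Λ`, so the estimate is
    -- uniform in the potential.
    have h2 : (∑ x ∈ Λ' \ Λ, (V r).toFun x) * b r - b r * ∑ x ∈ Λ' \ Λ, (V r).toFun x = 0 :=
      sub_eq_zero.2 (commute_of_disjoint (X := Λ' \ Λ) Finset.sdiff_disjoint
        (sum_mem fun x hx => (V r).mem_evenAlg hx) (hbΛ r))
    have h3 : ∑ Z ∈ 𝒵, ((Ψ r).toFun Z * b r - b r * (Ψ r).toFun Z) =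
        (∑ Z ∈ 𝒵, (Ψ r).toFun Z) * b r - b r * ∑ Z ∈ 𝒵, (Ψ r).toFun Z := by
      rw [Finset.sum_mul, Finset.mul_sum, Finset.sum_sub_distrib]
    congr 2
    change -(Complex.I • ham (Ψ r) (V r) Λ * b r - b r * Complex.I • ham (Ψ r) (V r) Λ) +
      (Complex.I • ham (Ψ r) (V r) Λ' * b r - b r * Complex.I • ham (Ψ r) (V r) Λ') = _
    simp only [smul_mul_assoc, mul_smul_comm, ← smul_sub, ← smul_neg, ← smul_add]
    congr 1
    rw [h3, ← sub_eq_zero, ← h2, h1]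
    noncomm_ring
  have key := norm_sub_le_of_norm_deriv_le s t hcd (C := 2 * α * ‖B‖ *
    Real.exp (2 * F.D * α * |t - s|) * (∑ x ∈ X, ∑ y ∈ Λ' \ Λ, F.kern x y)) (fun r _ hr => ?_)
  · simpa [hb, hW.diag, hW'.diag] using key
  · rw [hW'.norm_conj, norm_smul, Complex.norm_I, one_mul]
    have hgr : 0 ≤ F.growth α |t - r| := F.growth_nonneg hα0 (abs_nonneg _)
    have hk : ∀ x y, 0 ≤ F.lrKern (F.growth α |t - r|) x y := F.lrKern_nonneg hgr
    calc _ ≤ ∑ Z ∈ 𝒵, 2 * ‖B‖ * (‖(Ψ r).toFun Z‖ * ∑ z ∈ Z, ∑ x ∈ X,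
            F.lrKern (F.growth α |t - r|) x z) := by
          refine (norm_sum_le _ _).trans (Finset.sum_le_sum fun Z _ => ?_)
          rw [norm_sub_rev]
          refine (norm_commutator_conj_le_lrKern hΨ hΨc hVc hW
            ((Ψ r).mem_evenAlg (subset_refl Z)) hB t r).trans_eq ?_
          rw [Finset.sum_comm]
          ring
      -- Every remaining `Z` leaves `Λ`, hence meets `Λ' \ Λ`, which takes the role of the set met
      -- by the interaction terms.
      _ ≤ 2 * ‖B‖ * (α * ∑ y ∈ Λ' \ Λ, ∑ z ∈ Λ', F.kern y z * ∑ x ∈ X,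
            F.lrKern (F.growth α |t - r|) x z) := by
          rw [← Finset.mul_sum]
          refine mul_le_mul_of_nonneg_left (sum_norm_mul_sum_le hΨ r (Λ' \ Λ) Λ' 𝒵
            (fun Z hZ => Finset.mem_powerset.1 (Finset.mem_filter.1 hZ).1) (fun Z hZ => ?_) _
            (fun z => Finset.sum_nonneg fun x _ => hk x z)) (by positivity)
          obtain ⟨y, hyZ, hyΛ⟩ := Finset.not_subset.1 (Finset.mem_filter.1 hZ).2
          exact Finset.not_disjoint_iff.2 ⟨y, hyZ, Finset.mem_sdiff.2
            ⟨Finset.mem_powerset.1 (Finset.mem_filter.1 hZ).1 hyZ, hyΛ⟩⟩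
      _ ≤ 2 * ‖B‖ * (α * ∑ y ∈ Λ' \ Λ, ∑ x ∈ X,
            Real.exp (2 * F.D * α * |t - r|) * F.kern x y) := by
          refine mul_le_mul_of_nonneg_left (mul_le_mul_of_nonneg_left
            (Finset.sum_le_sum fun y _ => ?_) hα0) (by positivity)
          simp only [Finset.mul_sum]
          rw [Finset.sum_comm]
          refine Finset.sum_le_sum fun x _ => ?_
          simp only [F.lrKern_comm _ x]
          rw [← F.one_add_D_mul_growth, F.kern_comm x y]
          exact F.sum_kern_mul_lrKern_le hgr y x Λ'
      _ = 2 * α * ‖B‖ * Real.exp (2 * F.D * α * |t - r|) *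
            (∑ x ∈ X, ∑ y ∈ Λ' \ Λ, F.kern x y) := by
          rw [Finset.sum_comm]
          simp only [← Finset.mul_sum]
          ring
      _ ≤ _ := by
          have := F.D_pos
          refine mul_le_mul_of_nonneg_right ?_ (Finset.sum_nonneg fun x _ =>
            Finset.sum_nonneg fun y _ => (F.kern_pos x y).le)
          gcongr

end LiebRobinson

/-! ### The infinite-volume dynamics -/

section Dynamics

variable {d : ℕ} {F : DecayFunction d} {Ψ : ℝ → Interaction d} {V : ℝ → Potential d}

theorem exists_isHamPropagator (hΨc : ∀ Λ, Continuous fun t => (Ψ t).toFun Λ)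
    (hVc : ∀ y, Continuous fun t => (V t).toFun y) (Λ : Finset (Lattice d)) :
    ∃ W, IsHamPropagator Ψ V Λ W ∧ ∀ t s, W t s ∈ evenAlg Λ :=
  exists_isUnitaryPropagator (evenAlg Λ) (isClosed_evenAlg Λ)
    ((continuous_ham hΨc hVc Λ).fun_const_smul _) (star_I_smul_ham Ψ V Λ)
    (fun t => (evenAlg Λ).smul_mem (ham_mem_evenAlg (Ψ t) (V t) Λ) _)

theorem commOp_apply (a b : CAR d) : commOp a b = a * b - b * a := rfl

theorem derivation_apply (Φ : Interaction d) (V : Potential d) (L : ℝ≥0) (b : CAR d) :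
    derivation Φ V L b = Complex.I • ham Φ V (box (L : ℝ)) * b -
      b * Complex.I • ham Φ V (box (L : ℝ)) := by
  simp only [derivation, add_apply, smul_apply,
    sum_apply, commOp_apply, ham, smul_mul_assoc, mul_smul_comm,
    ← smul_sub, ← smul_add, Finset.sum_sub_distrib, Finset.sum_mul, Finset.mul_sum, add_mul,
    mul_add]
  congr 1
  abel

theorem hasDerivAt_mulLeft {f : ℝ → CAR d} {f' : CAR d} {t : ℝ} (hf : HasDerivAt f f' t) :
    HasDerivAt (fun r => ContinuousLinearMap.mul ℂ (CAR d) (f r))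
      (ContinuousLinearMap.mul ℂ (CAR d) f') t :=
  ((ContinuousLinearMap.mul ℂ (CAR d)).restrictScalars ℝ).hasFDerivAt.comp_hasDerivAt t hf

theorem hasDerivAt_mulRight {f : ℝ → CAR d} {f' : CAR d} {t : ℝ} (hf : HasDerivAt f f' t) :
    HasDerivAt (fun r => (ContinuousLinearMap.mul ℂ (CAR d)).flip (f r))
      ((ContinuousLinearMap.mul ℂ (CAR d)).flip f') t :=
  ((ContinuousLinearMap.mul ℂ (CAR d)).flip.restrictScalars ℝ).hasFDerivAt.comp_hasDerivAt t hf

theorem isFiniteVolumeDynamics_toCLM {L : ℝ≥0} {W : ℝ → ℝ → CAR d}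
    (hW : IsHamPropagator Ψ V (box (L : ℝ)) W) : IsFiniteVolumeDynamics Ψ V L hW.toCLM where
  deriv_left t s := by
    refine ((hasDerivAt_mulLeft (hW.deriv_left t s)).mul
      (hasDerivAt_mulRight (hasDerivAt_star (hW.deriv_left t s)))).congr_deriv ?_
    ext b
    rw [ContinuousLinearMap.comp_apply, hW.toCLM_apply, derivation_apply, star_mul,
      star_I_smul_ham]
    simp only [add_apply, ContinuousLinearMap.mul_def, ContinuousLinearMap.comp_apply,
      ContinuousLinearMap.mul_apply', ContinuousLinearMap.flip_apply]
    noncomm_ring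
  deriv_right t s := by
    refine ((hasDerivAt_mulLeft (hW.deriv_right t s)).mul
      (hasDerivAt_mulRight (hasDerivAt_star (hW.deriv_right t s)))).congr_deriv ?_
    ext b
    rw [neg_apply, ContinuousLinearMap.comp_apply, hW.toCLM_apply,
      derivation_apply, star_neg, star_mul, star_I_smul_ham]
    simp only [add_apply, ContinuousLinearMap.mul_def, ContinuousLinearMap.comp_apply,
      ContinuousLinearMap.mul_apply', ContinuousLinearMap.flip_apply]
    noncomm_ring
  diag s := by
    ext b
    simp [hW.toCLM_apply, hW.diag]

/-- The composition $\tau_{r,s}\tau'_{t,r}$ is constant in $r$, since the two derivations cancel;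
its values at $r=s$ and $r=t$ are the two dynamics. -/
theorem IsFiniteVolumeDynamics.unique {L : ℝ≥0} {τ τ' : ℝ → ℝ → CAR d →L[ℂ] CAR d}
    (h : IsFiniteVolumeDynamics Ψ V L τ) (h' : IsFiniteVolumeDynamics Ψ V L τ') : τ = τ' := by
  funext t s
  have hd : ∀ r, HasDerivAt (fun r => τ r s * τ' t r) 0 r := fun r => by
    refine ((h.deriv_left r s).mul (h'.deriv_right t r)).congr_deriv ?_
    ext b
    simp [ContinuousLinearMap.mul_def, ContinuousLinearMap.comp_apply]
  have key := norm_sub_le_of_norm_deriv_le s t hd (C := 0) (by simp)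
  rw [zero_mul, norm_le_zero_iff, sub_eq_zero, h.diag, h'.diag] at key
  exact key

theorem box_mono {L L' : ℝ} (h : L ≤ L') : (box L : Finset (Lattice d)) ⊆ box L' := fun x hx => by
  rw [mem_box] at hx ⊢
  exact fun i => (hx i).trans h

theorem exists_mem_box (x : Lattice d) : ∃ n : ℕ, x ∈ box (n : ℝ) := by
  obtain ⟨n, hn⟩ := exists_nat_ge (∑ i, |(x i : ℝ)|)
  refine ⟨n, (mem_box _ _).2 fun i => le_trans ?_ hn⟩
  exact Finset.single_le_sum (f := fun i => |(x i : ℝ)|) (fun i _ => abs_nonneg _)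
    (Finset.mem_univ i)

theorem tendsto_box : Filter.Tendsto (fun L : ℝ≥0 => (box (L : ℝ) : Finset (Lattice d)))
    Filter.atTop Filter.atTop :=
  Filter.tendsto_atTop_finset_of_monotone (fun _ _ h => box_mono (NNReal.coe_le_coe.2 h))
    fun x => (exists_mem_box x).imp' (fun n : ℕ => (n : ℝ≥0)) fun n hn => by simpa using hn

theorem mem_boxAt {L : ℝ} {x y : Lattice d} : y ∈ boxAt L x ↔ y - x ∈ box L := by
  rw [boxAt, Finset.mem_image]
  exact ⟨by rintro ⟨z, hz, rfl⟩; simpa using hz, fun h => ⟨y - x, h, sub_add_cancel y x⟩⟩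

theorem boxAt_mono {L L' : ℝ} (h : L ≤ L') (x : Lattice d) : boxAt L x ⊆ boxAt L' x :=
  Finset.image_subset_image (box_mono h)

theorem tendsto_boxAt (x : Lattice d) :
    Filter.Tendsto (fun n : ℕ => boxAt (n : ℝ) x) Filter.atTop Filter.atTop :=
  Filter.tendsto_atTop_finset_of_monotone (fun _ _ h => boxAt_mono (Nat.cast_le.2 h) x)
    fun y => (exists_mem_box (y - x)).imp fun _ hn => mem_boxAt.2 hn

/-- The volume comparison leaves a tail of the summable function $y\mapsto\sum_{x\in X}\mathbf
F(|x-y|)$. Convergence is along the directed set of all finite regions, not only along boxes. -/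
theorem cauchySeq_conj_of_mem_clAlg (hΨ : supNormW Ψ F < ⊤)
    (hΨc : ∀ Λ, Continuous fun t => (Ψ t).toFun Λ)
    (hVc : ∀ y, Continuous fun t => (V t).toFun y) {U : Finset (Lattice d) → ℝ → ℝ → CAR d}
    (hU : ∀ Λ, IsHamPropagator Ψ V Λ (U Λ)) (hUm : ∀ Λ t s, U Λ t s ∈ evenAlg Λ)
    {X : Finset (Lattice d)} {B : CAR d} (hB : B ∈ clAlg X) (t s : ℝ) :
    CauchySeq fun Λ => U Λ t s * B * star (U Λ t s) := by
  set C := 2 * (supNormW Ψ F).toReal * ‖B‖ *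
    Real.exp (2 * F.D * (supNormW Ψ F).toReal * |t - s|) * |t - s| with hC
  have hC0 : 0 ≤ C := by positivity
  have hsum : Summable fun y => ∑ x ∈ X, F.kern x y :=
    summable_sum fun x _ => F.summable_kern x
  refine Metric.cauchySeq_iff'.2 fun ε hε => ?_
  obtain ⟨S, hS⟩ := summable_iff_vanishing_norm.1 hsum (ε / (C + 1)) (by positivity)
  refine ⟨S ∪ X, fun Λ hΛ => ?_⟩
  rw [dist_eq_norm]
  refine (norm_conj_sub_conj_le hΨ hΨc hVc hΛ Finset.subset_union_right (hU _) (hUm _) (hU Λ)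
    hB t s).trans_lt ?_
  have h1 := hS (Λ \ (S ∪ X)) (Finset.disjoint_of_subset_right Finset.subset_union_left
    Finset.sdiff_disjoint)
  rw [Finset.sum_comm, mul_right_comm, ← hC]
  have h2 := (le_abs_self _).trans_lt h1
  rw [lt_div_iff₀ (by positivity)] at h2
  have h3 : 0 ≤ ∑ y ∈ Λ \ (S ∪ X), ∑ x ∈ X, F.kern x y :=
    Finset.sum_nonneg fun y _ => Finset.sum_nonneg fun x _ => (F.kern_pos x y).le
  linarith

/-- Local elements are dense and conjugation is isometric, uniformly in the region, so an
$\varepsilon/3$ argument applies. -/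
theorem cauchySeq_conj (hΨ : supNormW Ψ F < ⊤)
    (hΨc : ∀ Λ, Continuous fun t => (Ψ t).toFun Λ)
    (hVc : ∀ y, Continuous fun t => (V t).toFun y) {U : Finset (Lattice d) → ℝ → ℝ → CAR d}
    (hU : ∀ Λ, IsHamPropagator Ψ V Λ (U Λ)) (hUm : ∀ Λ t s, U Λ t s ∈ evenAlg Λ)
    (B : CAR d) (t s : ℝ) : CauchySeq fun Λ => U Λ t s * B * star (U Λ t s) := by
  refine Metric.cauchySeq_iff'.2 fun ε hε => ?_
  obtain ⟨X, c, hc, hBc⟩ := exists_local_norm_sub_lt B (ε := ε / 3) (by positivity)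
  obtain ⟨S, hS⟩ := Metric.cauchySeq_iff'.1 (cauchySeq_conj_of_mem_clAlg hΨ hΨc hVc hU hUm
    (localAlg_le_clAlg X hc) t s) (ε / 3) (by positivity)
  refine ⟨S, fun Λ hΛ => ?_⟩
  have h1 := hS Λ hΛ
  have hdiff : ∀ Λ, dist (U Λ t s * B * star (U Λ t s)) (U Λ t s * c * star (U Λ t s)) < ε / 3 :=
    fun Λ => by
      rw [dist_eq_norm, ← sub_mul, ← mul_sub, (hU Λ).norm_conj]
      exact hBc
  have h2 := hdiff Λ
  have h3 := hdiff S
  rw [dist_comm] at h3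
  have h4 := dist_triangle4 (U Λ t s * B * star (U Λ t s)) (U Λ t s * c * star (U Λ t s))
    (U S t s * c * star (U S t s)) (U S t s * B * star (U S t s))
  linarith

theorem exists_isInfiniteVolumeDynamics (hΨ : supNormW Ψ F < ⊤)
    (hΨc : ∀ Λ, Continuous fun t => (Ψ t).toFun Λ)
    (hVc : ∀ y, Continuous fun t => (V t).toFun y) : ∃ τ, IsInfiniteVolumeDynamics Ψ V τ := by
  choose U hU hUm using exists_isHamPropagator hΨc hVc (d := d)
  choose f hf using fun t s B => cauchySeq_tendsto_of_complete
    (cauchySeq_conj hΨ hΨc hVc hU hUm B t s)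
  have hlim : ∀ t s, Filter.Tendsto (fun (L : ℝ≥0) B => (hU (box (L : ℝ))).toCLM t s B)
      Filter.atTop (nhds (f t s)) := fun t s => tendsto_pi_nhds.2 fun B => by
    simp only [IsUnitaryPropagator.toCLM_apply]
    exact (hf t s B).comp tendsto_box
  -- Boundedness of the pointwise limit is the Banach–Steinhaus theorem.
  exact ⟨fun t s => continuousLinearMapOfTendsto _ (hlim t s),
    fun L => (hU (box (L : ℝ))).toCLM, fun L => isFiniteVolumeDynamics_toCLM _,
    fun t s B => tendsto_pi_nhds.1 (hlim t s) B⟩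

/-- The limit over all finite regions exists, and by uniqueness in finite volume it agrees with the
given dynamics along the boxes centred at the origin. It can then be evaluated along boxes centred
at any $x_j$. -/
theorem IsInfiniteVolumeDynamics.tendsto_conj {τ : ℝ → ℝ → CAR d →L[ℂ] CAR d}
    (hτ : IsInfiniteVolumeDynamics Ψ V τ) (hΨ : supNormW Ψ F < ⊤)
    (hΨc : ∀ Λ, Continuous fun t => (Ψ t).toFun Λ)
    (hVc : ∀ y, Continuous fun t => (V t).toFun y) {U : Finset (Lattice d) → ℝ → ℝ → CAR d}
    (hU : ∀ Λ, IsHamPropagator Ψ V Λ (U Λ)) (hUm : ∀ Λ t s, U Λ t s ∈ evenAlg Λ)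
    (B : CAR d) (t s : ℝ) :
    Filter.Tendsto (fun Λ => U Λ t s * B * star (U Λ t s)) Filter.atTop (nhds (τ t s B)) := by
  obtain ⟨τL, hτL, hlim⟩ := hτ
  obtain ⟨l, hl⟩ := cauchySeq_tendsto_of_complete (cauchySeq_conj hΨ hΨc hVc hU hUm B t s)
  have h1 := hl.comp (tendsto_box (d := d))
  have h2 : ((fun Λ => U Λ t s * B * star (U Λ t s)) ∘ fun L : ℝ≥0 => box (L : ℝ)) =
      fun L => τL L t s B := by
    funext L
    rw [(hτL L).unique (isFiniteVolumeDynamics_toCLM (hU (box (L : ℝ)))),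
      IsUnitaryPropagator.toCLM_apply]
    rfl
  rw [h2] at h1
  rwa [tendsto_nhds_unique (hlim t s B) h1]

end Dynamics

/-! ### Trees and multi-commutators -/

section Trees

theorem le_of_mem_trees {k : ℕ} {T : Finset (Sym2 ℕ)} (hT : T ∈ trees k) {i j : ℕ}
    (h : s(i, j) ∈ T) : i ≤ k ∧ j ≤ k := by
  induction k generalizing T with
  | zero =>
    rw [trees, Finset.mem_singleton] at hT
    simp [hT] at h
  | succ k ih =>
    rw [trees, Finset.mem_image] at hT
    obtain ⟨⟨p, T'⟩, hp, rfl⟩ := hT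
    rw [Finset.mem_product, Finset.mem_range] at hp
    rcases Finset.mem_insert.1 h with h | h
    · rw [Sym2.eq_iff] at h
      have := hp.1
      dsimp only at this h
      omega
    · have := ih hp.2 h
      omega

/-- Every choice of parents is realized by a tree. -/
theorem exists_mem_trees_parent_eq (k : ℕ) (p : ℕ → ℕ) (hp : ∀ j, 1 ≤ j → j ≤ k → p j < j) :
    ∃ T ∈ trees k, ∀ j, 1 ≤ j → j ≤ k → parent T j = p j := by
  induction k with
  | zero => exact ⟨∅, by simp [trees], fun j h1 h2 => by omega⟩
  | succ k ih =>
    obtain ⟨T, hT, hpar⟩ := ih fun j h1 h2 => hp j h1 (by omega)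
    have hk := hp (k + 1) (by omega) le_rfl
    refine ⟨insert s(p (k + 1), k + 1) T, ?_, fun j h1 h2 => ?_⟩
    · rw [trees, Finset.mem_image]
      exact ⟨(p (k + 1), T), Finset.mem_product.2 ⟨Finset.mem_range.2 hk, hT⟩, rfl⟩
    · rcases Nat.lt_or_ge k j with hj | hj
      · obtain rfl : j = k + 1 := by omega
        have : {i | i < k + 1 ∧ s(i, k + 1) ∈ insert s(p (k + 1), k + 1) T} = {p (k + 1)} := by
          ext i
          simp only [Set.mem_ofPred_eq, Finset.mem_insert, Set.mem_singleton_iff]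
          constructor
          · rintro ⟨hi, h | h⟩
            · rw [Sym2.eq_iff] at h
              omega
            · have := (le_of_mem_trees hT h).2
              omega
          · rintro rfl
            exact ⟨hk, Or.inl rfl⟩
        rw [parent, this, csInf_singleton]
      · rw [← hpar j h1 hj, parent, parent]
        congr 1
        ext i
        simp only [Set.mem_ofPred_eq, Finset.mem_insert]
        refine and_congr_right fun hi => or_iff_right fun h => ?_
        rw [Sym2.eq_iff] at h
        omega

end Trees

/-! ### Locality and norm bounds for multi-commutators -/

section MultiComm

variable {d : ℕ}

theorem multiComm_congr {A : Type*} [Ring A] {b c : ℕ → A} {k : ℕ} (h : ∀ j ≤ k, b j = c j) :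
    multiComm b k = multiComm c k := by
  induction k with
  | zero => exact h 0 le_rfl
  | succ k ih => rw [multiComm, multiComm, ih fun j hj => h j (by omega), h (k + 1) le_rfl]

theorem norm_multiComm_le {A : Type*} [NormedRing A] (b : ℕ → A) (k : ℕ) :
    ‖multiComm b k‖ ≤ 2 ^ k * ∏ j ∈ Finset.range (k + 1), ‖b j‖ := by
  induction k with
  | zero => simp [multiComm]
  | succ k ih =>
    rw [multiComm, Finset.prod_range_succ]
    refine (norm_commutator_le _ _).trans ?_
    calc 2 * ‖b (k + 1)‖ * ‖multiComm b k‖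
        ≤ 2 * ‖b (k + 1)‖ * (2 ^ k * ∏ j ∈ Finset.range (k + 1), ‖b j‖) := by gcongr
      _ = _ := by ring

theorem tendsto_multiComm {A ι : Type*} [NormedRing A] {l : Filter ι} {f : ι → ℕ → A} {b : ℕ → A}
    {k : ℕ} (h : ∀ j ≤ k, Filter.Tendsto (fun i => f i j) l (nhds (b j))) :
    Filter.Tendsto (fun i => multiComm (f i) k) l (nhds (multiComm b k)) := by
  induction k with
  | zero => exact h 0 le_rfl
  | succ k ih =>
    have h1 := ih fun j hj => h j (by omega)
    have h2 := h (k + 1) le_rfl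
    exact (h2.mul h1).sub (h1.mul h2)

theorem multiComm_mem_clAlg {b : ℕ → CAR d} {S : ℕ → Finset (Lattice d)} {k : ℕ}
    (h : ∀ j ≤ k, b j ∈ clAlg (S j)) :
    multiComm b k ∈ clAlg ((Finset.range (k + 1)).biUnion S) := by
  induction k with
  | zero => simpa [multiComm] using h 0 le_rfl
  | succ k ih =>
    have h1 := clAlg_mono (Finset.biUnion_subset_biUnion_of_subset_left S
      (Finset.range_mono (Nat.le_succ (k + 1)))) (ih fun j hj => h j (by omega))
    have h2 := clAlg_mono (Finset.subset_biUnion_of_mem S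
      (Finset.self_mem_range_succ (k + 1))) (h (k + 1) le_rfl)
    exact sub_mem (mul_mem h2 h1) (mul_mem h1 h2)

/-- The inner multi-commutator is localized in the union of the earlier supports. An even entry
whose support avoids this union commutes with it, and the zero propagates outwards. -/
theorem exists_inter_nonempty_of_multiComm_ne_zero {b : ℕ → CAR d} {S : ℕ → Finset (Lattice d)}
    {k : ℕ} (h0 : b 0 ∈ clAlg (S 0)) (h : ∀ j, 1 ≤ j → j ≤ k → b j ∈ evenAlg (S j))
    (hne : multiComm b k ≠ 0) (j : ℕ) (hj : 1 ≤ j) (hjk : j ≤ k) :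
    ∃ i < j, (S j ∩ S i).Nonempty := by
  induction k with
  | zero => omega
  | succ k ih =>
    have hne' : multiComm b k ≠ 0 := fun h0 => hne (by simp [multiComm, h0])
    rcases Nat.lt_or_ge k j with hjk' | hjk'
    · obtain rfl : j = k + 1 := by omega
      by_contra! hcon
      refine hne (sub_eq_zero.2 (commute_of_disjoint (X := S (k + 1))
        (Y := (Finset.range (k + 1)).biUnion S) ?_ (h (k + 1) hj le_rfl)
        (multiComm_mem_clAlg fun i hi => ?_)))
      · rw [Finset.disjoint_biUnion_right]
        intro i hi
        exact Finset.disjoint_iff_inter_eq_empty.2 (hcon i (Finset.mem_range.1 hi))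
      · rcases Nat.eq_zero_or_pos i with rfl | hi0
        · exact h0
        · exact evenAlg_le_clAlg _ (h i hi0 (by omega))
    · exact ih (fun j h1 h2 => h j h1 (by omega)) hne' hjk'

theorem kappa_nonneg (k : ℕ) (T : Finset (Sym2 ℕ)) (n : ℕ → ℕ) (x : ℕ → Lattice d) :
    0 ≤ kappa k T n x :=
  Finset.prod_nonneg fun j _ => by split_ifs <;> norm_num

theorem kappa_le_one (k : ℕ) (T : Finset (Sym2 ℕ)) (n : ℕ → ℕ) (x : ℕ → Lattice d) :
    kappa k T n x ≤ 1 :=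
  Finset.prod_le_one (fun j _ => by split_ifs <;> norm_num) fun j _ => by split_ifs <;> norm_num

/-- The tree bound for multi-commutators of elements localized in boxes. -/
theorem norm_multiComm_le_sum_kappa {b : ℕ → CAR d} {k : ℕ} {n : ℕ → ℕ} {x : ℕ → Lattice d}
    (h0 : b 0 ∈ clAlg (boxAt (n 0) (x 0)))
    (h : ∀ j, 1 ≤ j → j ≤ k → b j ∈ evenAlg (boxAt (n j) (x j))) :
    ‖multiComm b k‖ ≤
      2 ^ k * (∏ j ∈ Finset.range (k + 1), ‖b j‖) * ∑ T ∈ trees k, kappa k T n x := by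
  have hnn : 0 ≤ ∑ T ∈ trees k, kappa k T n x :=
    Finset.sum_nonneg fun T _ => kappa_nonneg k T n x
  by_cases hne : multiComm b k = 0
  · rw [hne, norm_zero]
    positivity
  refine (norm_multiComm_le b k).trans (le_mul_of_one_le_right (by positivity) ?_)
  have hex := exists_inter_nonempty_of_multiComm_ne_zero (S := fun j => boxAt (n j) (x j)) h0 h hne
  -- The chosen earlier vertex serves as the parent of `j`. The tree with these parents has `kappa`
  -- equal to one, so the sum over trees is at least one.
  choose! p hp using hex
  obtain ⟨T, hT, hpar⟩ := exists_mem_trees_parent_eq k p fun j h1 h2 => (hp j h1 h2).1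
  refine le_trans (le_of_eq ?_) (Finset.single_le_sum (fun T _ => kappa_nonneg k T n x) hT)
  refine (Finset.prod_eq_one fun j hj => ?_).symm
  rw [Finset.mem_Icc] at hj
  rw [if_pos]
  rw [hpar j hj.1 hj.2]
  exact (hp j hj.1 hj.2).2

end MultiComm

/-! ### Multilinear expansion over box sizes -/

section Expansion

open Classical in
/-- The sequences `ν` with `ν_j ∈ I_j` for `1 ≤ j ≤ k` and `ν_j = m_j` for all other `j`. -/
noncomputable def multiIndices (m : ℕ → ℕ) (I : ℕ → Finset ℕ) : ℕ → Finset (ℕ → ℕ)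
  | 0 => {m}
  | k + 1 => (multiIndices m I k ×ˢ I (k + 1)).image fun p => Function.update p.1 (k + 1) p.2

variable {m : ℕ → ℕ} {I : ℕ → Finset ℕ}

theorem mem_multiIndices {k : ℕ} {ν : ℕ → ℕ} (h : ν ∈ multiIndices m I k) :
    (∀ j, 1 ≤ j → j ≤ k → ν j ∈ I j) ∧ ∀ j, j = 0 ∨ k < j → ν j = m j := by
  classical
  induction k generalizing ν with
  | zero =>
    rw [multiIndices, Finset.mem_singleton] at h
    subst h
    exact ⟨fun j h1 h2 => by omega, fun _ _ => rfl⟩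
  | succ k ih =>
    rw [multiIndices, Finset.mem_image] at h
    obtain ⟨⟨μ, n⟩, hp, rfl⟩ := h
    rw [Finset.mem_product] at hp
    obtain ⟨h1, h2⟩ := ih hp.1
    refine ⟨fun j hj hjk => ?_, fun j hj => ?_⟩
    · rcases eq_or_ne j (k + 1) with rfl | hne
      · simpa using hp.2
      · rw [Function.update_of_ne hne]
        exact h1 j hj (by omega)
    · rw [Function.update_of_ne (by omega)]
      exact h2 j (by omega)

theorem sum_multiIndices_succ {M : Type*} [AddCommMonoid M] (k : ℕ) (f : (ℕ → ℕ) → M) :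
    ∑ ν ∈ multiIndices m I (k + 1), f ν =
      ∑ ν ∈ multiIndices m I k, ∑ n ∈ I (k + 1), f (Function.update ν (k + 1) n) := by
  classical
  rw [multiIndices, Finset.sum_image, Finset.sum_product]
  rintro ⟨ν, n⟩ h ⟨ν', n'⟩ h' heq
  rw [Finset.mem_coe, Finset.mem_product] at h h'
  dsimp only at heq h h'
  -- Overwriting the entry `k + 1` loses no information, since in both sequences it still has the
  -- default value `m (k + 1)`.
  refine Prod.ext (funext fun j => ?_) ?_
  · rcases eq_or_ne j (k + 1) with rfl | hne
    · exact ((mem_multiIndices h.1).2 _ (by omega)).trans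
        ((mem_multiIndices h'.1).2 _ (by omega)).symm
    · simpa [hne] using congrFun heq j
  · simpa using congrFun heq (k + 1)

/-- Multi-linearity of the multi-commutator. -/
theorem multiComm_sum {A : Type*} [Ring A] (β : ℕ → ℕ → A) (k : ℕ) :
    multiComm (fun j => if j = 0 then β 0 (m 0) else ∑ n ∈ I j, β j n) k =
      ∑ ν ∈ multiIndices m I k, multiComm (fun j => β j (ν j)) k := by
  induction k with
  | zero => simp [multiComm, multiIndices]
  | succ k ih =>
    rw [multiComm, ih, sum_multiIndices_succ, if_neg (Nat.succ_ne_zero k), Finset.sum_mul_sum,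
      Finset.sum_mul_sum, Finset.sum_comm, ← Finset.sum_sub_distrib]
    refine Finset.sum_congr rfl fun ν _ => ?_
    rw [← Finset.sum_sub_distrib]
    refine Finset.sum_congr rfl fun n _ => ?_
    have : multiComm (fun j => β j (Function.update ν (k + 1) n j)) k =
        multiComm (fun j => β j (ν j)) k :=
      multiComm_congr fun j hj => by rw [Function.update_of_ne (by omega)]
    rw [multiComm, this, Function.update_self]

end Expansion

/-! ### Sums over subsets and over increasing maps -/

section IncreasingMaps

theorem card_imageSet {l k : ℕ} {π : Finset.Icc l k → Finset.Icc 1 k} (hπ : StrictMono π) :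
    (imageSet π).card = k + 1 - l := by
  rw [imageSet, Finset.card_image_of_injective _ fun i i' h => hπ.injective (Subtype.ext h),
    Finset.card_univ, Fintype.card_coe, Nat.card_Icc]

theorem exists_imageSet_eq {l k : ℕ} {J : Finset ℕ} (hJ : J ⊆ Finset.Icc 1 k)
    (hc : J.card = k + 1 - l) : ∃ π ∈ increasingMaps l k, imageSet π = J := by
  have hI : (Finset.Icc l k).card = k + 1 - l := Nat.card_Icc l k
  let e : Finset.Icc l k ≃o J :=
    ((Finset.Icc l k).orderIsoOfFin hI).symm.trans (J.orderIsoOfFin hc)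
  refine ⟨fun i => ⟨e i, hJ (e i).2⟩, ?_, ?_⟩
  · rw [increasingMaps, Finset.mem_filter]
    exact ⟨Finset.mem_univ _, fun i i' h => e.strictMono h⟩
  · ext j
    rw [imageSet, Finset.mem_image]
    constructor
    · rintro ⟨i, -, rfl⟩
      exact (e i).2
    · intro hj
      exact ⟨e.symm ⟨j, hj⟩, Finset.mem_univ _, by simp⟩

/-- A non-empty $J$ of cardinality $k+1-\ell$ is the image of an increasing map on
$\{\ell,\dots,k\}$. Only this surjectivity is used, which is enough for an inequality. -/
theorem sum_powerset_le_sum_increasingMaps (k : ℕ) (g : Finset ℕ → ℝ) (hg : ∀ J, 0 ≤ g J) :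
    ∑ J ∈ (Finset.Icc 1 k).powerset, g J ≤
      g ∅ + ∑ l ∈ Finset.Icc 1 k, ∑ π ∈ increasingMaps l k, g (imageSet π) := by
  classical
  have h1 : ∀ l, ∑ J ∈ Finset.powersetCard (k + 1 - l) (Finset.Icc 1 k), g J ≤
      ∑ π ∈ increasingMaps l k, g (imageSet π) := fun l => by
    have hsub : Finset.powersetCard (k + 1 - l) (Finset.Icc 1 k) ⊆
        (increasingMaps l k).image imageSet := fun J hJ => by
      rw [Finset.mem_powersetCard] at hJ
      exact Finset.mem_image.2 (exists_imageSet_eq hJ.1 hJ.2)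
    refine (Finset.sum_le_sum_of_subset_of_nonneg hsub fun J _ _ => hg J).trans ?_
    exact Finset.sum_image_le_of_nonneg fun J _ => hg J
  rw [Finset.sum_powerset, Nat.card_Icc, add_tsub_cancel_right, Finset.sum_range_succ', add_comm]
  refine add_le_add (by simp) (le_trans (le_of_eq ?_) (Finset.sum_le_sum fun l _ => h1 l))
  refine Finset.sum_nbij' (fun j => k - j) (fun l => k - l) ?_ ?_ ?_ ?_ ?_
  · intro j hj
    rw [Finset.mem_range] at hj
    rw [Finset.mem_Icc]
    omega
  · intro l hl
    rw [Finset.mem_Icc] at hl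
    rw [Finset.mem_range]
    omega
  · intro j hj
    rw [Finset.mem_range] at hj
    omega
  · intro l hl
    rw [Finset.mem_Icc] at hl
    omega
  · intro j hj
    rw [Finset.mem_range] at hj
    rw [show k + 1 - (k - j) = j + 1 by omega]

end IncreasingMaps

/-! ### Sums over shells and the remainder term -/

section Shells

variable {d : ℕ} (F : DecayFunction d)

/-- The sum of `F(|z - y|)` over `z ∈ Λ_m` and `y ∈ Λ_n \ Λ_{n-1}`. -/
noncomputable def shellSum (m n : ℕ) : ℝ :=
  ∑ z ∈ box (d := d) m, ∑ y ∈ box (d := d) n \ box ((n : ℝ) - 1), F.toFun (len (z - y))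

theorem shellSum_nonneg (m n : ℕ) : 0 ≤ shellSum F m n :=
  Finset.sum_nonneg fun _ _ => Finset.sum_nonneg fun _ _ => (F.pos _).le

theorem prod_shellSum {J : Type*} [Fintype J] [DecidableEq J] (m n : J → ℕ) :
    ∏ j : J, shellSum F (m j) (n j) =
      ∑ z ∈ Fintype.piFinset fun j => box (d := d) (m j),
        ∑ y ∈ Fintype.piFinset fun j => box (d := d) (n j) \ box ((n j : ℝ) - 1),
          ∏ j, F.toFun (len (z j - y j)) := by
  simp only [shellSum]
  rw [Finset.prod_univ_sum]
  refine Finset.sum_congr rfl fun z _ => ?_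
  rw [Finset.prod_univ_sum]

/-- The shells are pairwise disjoint, so for each fixed $z$ their contributions add up to at most
$\sum_x \mathbf F(|x|)$. -/
theorem sum_shellSum_le (m : ℕ) (A : Finset ℕ) :
    ∑ n ∈ A, shellSum F m n ≤ (box (d := d) m).card * F.mass := by
  simp only [shellSum]
  rw [Finset.sum_comm, ← nsmul_eq_mul]
  refine Finset.sum_le_card_nsmul _ _ _ fun z _ => ?_
  rw [← Finset.sum_biUnion]
  · exact F.sum_kern_le z _
  · have key : ∀ n n' : ℕ, n < n' → Disjoint (box (d := d) n \ box ((n : ℝ) - 1))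
        (box (d := d) n' \ box ((n' : ℝ) - 1)) := fun n n' h => by
      have h1 : (n : ℝ) ≤ (n' : ℝ) - 1 := by
        rw [le_sub_iff_add_le]
        exact_mod_cast h
      exact Finset.disjoint_of_subset_left (Finset.sdiff_subset.trans (box_mono h1))
        Finset.disjoint_sdiff
    intro n _ n' _ hne
    rcases Nat.lt_or_gt_of_ne hne with h | h
    · exact key n n' h
    · exact (key n' n h).symm

theorem sum_prod_le_prod {J : Type*} [Fintype J] [DecidableEq J] {g : J → ℕ → ℝ}
    (hg : ∀ j n, 0 ≤ g j n) {C : J → ℝ} (hC : ∀ j (A : Finset ℕ), ∑ n ∈ A, g j n ≤ C j)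
    (u : Finset (J → ℕ)) : ∑ n ∈ u, ∏ j, g j (n j) ≤ ∏ j, C j := by
  calc ∑ n ∈ u, ∏ j, g j (n j)
      ≤ ∑ n ∈ Fintype.piFinset fun j => u.image fun n => n j, ∏ j, g j (n j) :=
        Finset.sum_le_sum_of_subset_of_nonneg
          (fun n hn => Fintype.mem_piFinset.2 fun j => Finset.mem_image_of_mem _ hn)
          fun n _ _ => Finset.prod_nonneg fun j _ => hg j (n j)
    _ = ∏ j, ∑ n ∈ u.image fun n => n j, g j n := (Finset.prod_univ_sum _ _).symm
    _ ≤ ∏ j, C j :=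
        Finset.prod_le_prod (fun j _ => Finset.sum_nonneg fun n _ => hg j n) fun j _ => hC j _

/-- Needed before partial sums can be compared with the infinite sum in the remainder, whose value
would default to zero without summability. Domination is by a product of summable functions of one
variable. -/
theorem summable_kappa_mul_prod_shellSum (k : ℕ) (T : Finset (Sym2 ℕ)) (m : ℕ → ℕ)
    (x : ℕ → Lattice d) (J : Finset ℕ) :
    Summable fun n : {n : J → ℕ // ∀ j : J, m j + 1 ≤ n j} =>
      kappa k T (extendBy J n.1 m) x * ∏ j : J, shellSum F (m j) (n.1 j) := by
  have hp : ∀ n : J → ℕ, 0 ≤ ∏ j : J, shellSum F (m j) (n j) := fun n =>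
    Finset.prod_nonneg fun j _ => shellSum_nonneg F _ _
  have hs : Summable fun n : J → ℕ => ∏ j : J, shellSum F (m j) (n j) :=
    summable_of_sum_le hp (sum_prod_le_prod (g := fun j : J => shellSum F (m j))
      (fun j n => shellSum_nonneg F _ _) fun j A => sum_shellSum_le F _ A)
  refine Summable.of_nonneg_of_le (fun n => mul_nonneg (kappa_nonneg _ _ _ _) (hp n.1))
    (fun n => ?_) (hs.comp_injective Subtype.val_injective)
  exact mul_le_of_le_one_left (hp n.1) (kappa_le_one _ _ _ _)

/-- The contribution to the remainder of the index set `J`. -/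
noncomputable def remainderTerm (k : ℕ) (T : Finset (Sym2 ℕ)) (c : ℕ → ℝ) (m : ℕ → ℕ)
    (x : ℕ → Lattice d) (J : Finset ℕ) : ℝ :=
  (∏ j ∈ J, c j) * ∑' n : {n : J → ℕ // ∀ j : J, m j + 1 ≤ n j},
    kappa k T (extendBy J n.1 m) x * ∏ j : J, shellSum F (m j) (n.1 j)

theorem remainderTerm_nonneg (k : ℕ) (T : Finset (Sym2 ℕ)) {c : ℕ → ℝ} (hc : ∀ j, 0 ≤ c j)
    (m : ℕ → ℕ) (x : ℕ → Lattice d) (J : Finset ℕ) : 0 ≤ remainderTerm F k T c m x J :=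
  mul_nonneg (Finset.prod_nonneg fun j _ => hc j) (tsum_nonneg fun _ =>
    mul_nonneg (kappa_nonneg _ _ _ _) (Finset.prod_nonneg fun _ _ => shellSum_nonneg F _ _))

theorem remainderTerm_empty (k : ℕ) (T : Finset (Sym2 ℕ)) (c : ℕ → ℝ) (m : ℕ → ℕ)
    (x : ℕ → Lattice d) : remainderTerm F k T c m x ∅ = kappa k T m x := by
  let n₀ : {n : (∅ : Finset ℕ) → ℕ // ∀ j : (∅ : Finset ℕ), m j + 1 ≤ n j} :=
    ⟨fun _ => 0, fun j => absurd j.2 (Finset.notMem_empty _)⟩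
  have hext : extendBy ∅ n₀.1 m = m := by
    funext j
    simp [extendBy]
  have huniq : ∀ n, n = n₀ := fun n =>
    Subtype.ext (funext fun j => absurd j.2 (Finset.notMem_empty _))
  rw [remainderTerm, tsum_eq_single n₀ fun n hn => absurd (huniq n) hn, hext]
  simp

theorem remainder_eq_sum_remainderTerm (k : ℕ) (T : Finset (Sym2 ℕ)) (α : ℝ) (t : ℕ → ℝ)
    (m : ℕ → ℕ) (x : ℕ → Lattice d) :
    remainder F k T α t m x = ∑ l ∈ Finset.Icc 1 k, ∑ π ∈ increasingMaps l k,
      remainderTerm F k T (fun j => 2 * α * (|t j| * Real.exp (4 * F.D * α * |t j|))) m x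
        (imageSet π) := by
  rw [remainder]
  refine Finset.sum_congr rfl fun l hl => ?_
  rw [Finset.mul_sum]
  refine Finset.sum_congr rfl fun π hπ => ?_
  -- This cardinality lets the prefactor $(2\alpha)^{k-\ell+1}$ be distributed as one factor
  -- $2\alpha$ per index of `J`.
  have hcard : (imageSet π).card = k - l + 1 := by
    rw [card_imageSet (Finset.mem_filter.1 hπ).2]
    rw [Finset.mem_Icc] at hl
    omega
  have hprod : ∏ j ∈ imageSet π, 2 * α * (|t j| * Real.exp (4 * F.D * α * |t j|)) =
      (2 * α) ^ (k - l + 1) * ∏ j ∈ imageSet π, |t j| * Real.exp (4 * F.D * α * |t j|) := by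
    rw [Finset.prod_mul_distrib, Finset.prod_const, hcard]
  rw [remainderTerm, hprod]
  simp only [prod_shellSum, Finset.mul_sum]
  ring

/-- The weights `1` for `n = m_j` and `c_j ∑_{z, y} F(|z - y|)` for all other `n`. -/
noncomputable def shellWeight (c : ℕ → ℝ) (m : ℕ → ℕ) (j n : ℕ) : ℝ :=
  if n = m j then 1 else c j * shellSum F (m j) n

theorem extendBy_injective (J : Finset ℕ) (m : ℕ → ℕ) :
    Function.Injective fun n : {n : J → ℕ // ∀ j : J, m j + 1 ≤ n j} => extendBy J n.1 m := by
  intro n n' h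
  refine Subtype.ext (funext fun j => ?_)
  have := congrFun h j
  simpa [extendBy, j.2] using this

theorem prod_shellWeight_extendBy {k : ℕ} (c : ℕ → ℝ) (m : ℕ → ℕ) {J : Finset ℕ}
    (hJ : J ⊆ Finset.Icc 1 k) (n : {n : J → ℕ // ∀ j : J, m j + 1 ≤ n j}) :
    ∏ j ∈ Finset.Icc 1 k, shellWeight F c m j (extendBy J n.1 m j) =
      (∏ j ∈ J, c j) * ∏ j : J, shellSum F (m j) (n.1 j) := by
  rw [← Finset.prod_subset hJ, ← Finset.prod_coe_sort J, ← Finset.prod_coe_sort J,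
    ← Finset.prod_mul_distrib]
  · refine Finset.prod_congr rfl fun j _ => ?_
    have h1 : extendBy J n.1 m j = n.1 j := by simp [extendBy]
    have h2 := n.2 j
    rw [h1, shellWeight, if_neg (by omega)]
  · intro j _ hj
    simp [extendBy, hj, shellWeight]

/-- Multi-indices are sorted by the set $J$ where they differ from `m`. On one fibre a multi-index
is determined by its restriction to $J$, so the fibre contributes a finite partial sum of the series
for $J$. -/
theorem sum_multiIndices_le (k : ℕ) (T : Finset (Sym2 ℕ)) {c : ℕ → ℝ} (hc : ∀ j, 0 ≤ c j)
    (m : ℕ → ℕ) (x : ℕ → Lattice d) (N : ℕ) :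
    ∑ ν ∈ multiIndices m (fun j => Finset.Icc (m j) N) k,
        kappa k T ν x * ∏ j ∈ Finset.Icc 1 k, shellWeight F c m j (ν j) ≤
      ∑ J ∈ (Finset.Icc 1 k).powerset, remainderTerm F k T c m x J := by
  classical
  set 𝒩 := multiIndices m (fun j => Finset.Icc (m j) N) k with h𝒩
  rw [← Finset.sum_fiberwise_of_maps_to (s := 𝒩) (t := (Finset.Icc 1 k).powerset)
    (g := fun ν => (Finset.Icc 1 k).filter fun j => ν j ≠ m j)
    fun ν _ => Finset.mem_powerset.2 (Finset.filter_subset _ _)]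
  refine Finset.sum_le_sum fun J hJ => ?_
  rw [Finset.mem_powerset] at hJ
  set S := 𝒩.filter fun ν => (Finset.Icc 1 k).filter (fun j => ν j ≠ m j) = J with hS
  have hrange : ∀ ν ∈ S, ν ∈ Set.range
      fun n : {n : J → ℕ // ∀ j : J, m j + 1 ≤ n j} => extendBy J n.1 m := fun ν hν => by
    obtain ⟨hν, hνJ⟩ := Finset.mem_filter.1 hν
    obtain ⟨h1, h2⟩ := mem_multiIndices hν
    have hmem : ∀ j, j ∈ J ↔ (1 ≤ j ∧ j ≤ k) ∧ ν j ≠ m j := fun j => by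
      rw [← hνJ, Finset.mem_filter, Finset.mem_Icc]
    refine ⟨⟨fun j => ν j, fun j => ?_⟩, funext fun j => ?_⟩
    · obtain ⟨⟨hj1, hjk⟩, hne⟩ := (hmem j).1 j.2
      have := (Finset.mem_Icc.1 (h1 j hj1 hjk)).1
      exact lt_of_le_of_ne this hne.symm
    · by_cases hj : j ∈ J
      · simp [extendBy, hj]
      · simp only [extendBy, hj, dite_false]
        by_contra hne
        by_cases hjk : 1 ≤ j ∧ j ≤ k
        · exact hj ((hmem j).2 ⟨hjk, fun h => hne h.symm⟩)
        · exact hne (h2 j (by omega)).symm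
  rw [← Finset.sum_preimage (fun n : {n : J → ℕ // ∀ j : J, m j + 1 ≤ n j} => extendBy J n.1 m) S
    (extendBy_injective J m).injOn _ fun ν hν hν' => absurd (hrange ν hν) hν']
  simp only [prod_shellWeight_extendBy F c m hJ]
  rw [remainderTerm, ← (summable_kappa_mul_prod_shellSum F k T m x J).tsum_mul_left]
  refine le_trans (le_of_eq (Finset.sum_congr rfl fun n _ => ?_))
    (((summable_kappa_mul_prod_shellSum F k T m x J).mul_left (∏ j ∈ J, c j)).sum_le_tsum _
      fun n _ => mul_nonneg (Finset.prod_nonneg fun j _ => hc j)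
        (mul_nonneg (kappa_nonneg _ _ _ _) (Finset.prod_nonneg fun _ _ => shellSum_nonneg F _ _)))
  ring

theorem sum_multiIndices_le_kappa_add_remainder (k : ℕ) (T : Finset (Sym2 ℕ)) {α : ℝ}
    (hα : 0 ≤ α) (t : ℕ → ℝ) (m : ℕ → ℕ) (x : ℕ → Lattice d) (N : ℕ) :
    ∑ ν ∈ multiIndices m (fun j => Finset.Icc (m j) N) k,
        kappa k T ν x * ∏ j ∈ Finset.Icc 1 k, shellWeight F
          (fun j => 2 * α * (|t j| * Real.exp (4 * F.D * α * |t j|))) m j (ν j) ≤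
      kappa k T m x + remainder F k T α t m x := by
  have hc : ∀ j, 0 ≤ 2 * α * (|t j| * Real.exp (4 * F.D * α * |t j|)) := fun j => by positivity
  refine (sum_multiIndices_le F k T hc m x N).trans ?_
  refine (sum_powerset_le_sum_increasingMaps k _ (remainderTerm_nonneg F k T hc m x)).trans_eq ?_
  rw [remainderTerm_empty, remainder_eq_sum_remainderTerm]

theorem sum_boxAt_shell (m n : ℕ) (hn : 1 ≤ n) (x : Lattice d) :
    ∑ z ∈ boxAt m x, ∑ y ∈ boxAt n x \ boxAt ((n - 1 : ℕ) : ℝ) x, F.kern z y =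
      shellSum F m n := by
  have hinj : Function.Injective fun y : Lattice d => y + x := add_left_injective x
  rw [Nat.cast_sub hn, Nat.cast_one, boxAt, boxAt, boxAt, ← Finset.image_sdiff _ _ hinj,
    Finset.sum_image hinj.injOn, shellSum]
  refine Finset.sum_congr rfl fun z _ => ?_
  rw [Finset.sum_image hinj.injOn]
  refine Finset.sum_congr rfl fun y _ => ?_
  rw [DecayFunction.kern, add_sub_add_right_eq_sub]

end Shells

/-! ### The multi-commutator bound -/

section Main

variable {d : ℕ} {F : DecayFunction d} {Ψ : ℝ → Interaction d} {V : ℝ → Potential d}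

/-- The `n`-th term of the expansion of `τ_{t,s}(B)` in the dynamics of the boxes `Λ_n + x`,
`n ≥ m`. -/
noncomputable def shellTerm (U : Finset (Lattice d) → ℝ → ℝ → CAR d) (t s : ℝ) (x : Lattice d)
    (B : CAR d) (m n : ℕ) : CAR d :=
  if n = m then U (boxAt n x) t s * B * star (U (boxAt n x) t s)
  else U (boxAt n x) t s * B * star (U (boxAt n x) t s) -
    U (boxAt ((n - 1 : ℕ) : ℝ) x) t s * B * star (U (boxAt ((n - 1 : ℕ) : ℝ) x) t s)

theorem sum_shellTerm (U : Finset (Lattice d) → ℝ → ℝ → CAR d) (t s : ℝ) (x : Lattice d)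
    (B : CAR d) {m N : ℕ} (h : m ≤ N) :
    ∑ n ∈ Finset.Icc m N, shellTerm U t s x B m n =
      U (boxAt N x) t s * B * star (U (boxAt N x) t s) := by
  induction N, h using Nat.le_induction with
  | base => simp [shellTerm]
  | succ N h ih =>
    rw [Finset.sum_Icc_succ_top (by omega), ih, shellTerm, if_neg (by omega),
      Nat.add_sub_cancel]
    abel

theorem shellTerm_mem_evenAlg {U : Finset (Lattice d) → ℝ → ℝ → CAR d}
    (hUm : ∀ Λ t s, U Λ t s ∈ evenAlg Λ) (t s : ℝ) {x : Lattice d} {B : CAR d} {m n : ℕ}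
    (hB : B ∈ evenAlg (boxAt m x)) (h : m ≤ n) :
    shellTerm U t s x B m n ∈ evenAlg (boxAt n x) := by
  have key : ∀ n', m ≤ n' → n' ≤ n →
      U (boxAt n' x) t s * B * star (U (boxAt n' x) t s) ∈ evenAlg (boxAt n x) :=
    fun n' h1 h2 => evenAlg_mono (boxAt_mono (Nat.cast_le.2 h2) x) (mul_mem (mul_mem (hUm _ t s)
      (evenAlg_mono (boxAt_mono (Nat.cast_le.2 h1) x) hB)) (star_mem (hUm _ t s)))
  unfold shellTerm
  split_ifs with hn
  · exact key n h le_rfl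
  · exact sub_mem (key n h le_rfl) (key (n - 1) (by omega) (by omega))

theorem norm_shellTerm_le (hΨ : supNormW Ψ F < ⊤)
    (hΨc : ∀ Λ, Continuous fun t => (Ψ t).toFun Λ)
    (hVc : ∀ y, Continuous fun t => (V t).toFun y) {U : Finset (Lattice d) → ℝ → ℝ → CAR d}
    (hU : ∀ Λ, IsHamPropagator Ψ V Λ (U Λ)) (hUm : ∀ Λ t s, U Λ t s ∈ evenAlg Λ)
    (t : ℕ → ℝ) (s : ℝ) {x : Lattice d} {B : CAR d} (m : ℕ → ℕ) (j : ℕ) {n : ℕ}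
    (hB : B ∈ clAlg (boxAt (m j) x)) (h : m j ≤ n) :
    ‖shellTerm U (t j) s x B (m j) n‖ ≤ ‖B‖ * shellWeight F
      (fun j => 2 * (supNormW Ψ F).toReal * (|t j - s| *
        Real.exp (4 * F.D * (supNormW Ψ F).toReal * |t j - s|))) m j n := by
  unfold shellTerm shellWeight
  split_ifs with hn
  · rw [(hU _).norm_conj, mul_one]
  · have hD := F.D_pos
    set α := (supNormW Ψ F).toReal with hα
    have hα0 : 0 ≤ α := ENNReal.toReal_nonneg
    have hs := shellSum_nonneg F (m j) n
    refine (norm_conj_sub_conj_le hΨ hΨc hVc (boxAt_mono (Nat.cast_le.2 (Nat.sub_le n 1)) x)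
      (boxAt_mono (Nat.cast_le.2 (by omega)) x) (hU _) (hUm _) (hU _) hB (t j) s).trans ?_
    rw [sum_boxAt_shell F (m j) n (by omega)]
    calc _ = ‖B‖ * (2 * α * (|t j - s| * Real.exp (2 * F.D * α * |t j - s|)) *
            shellSum F (m j) n) := by ring
      -- The volume comparison gives the exponent $2\mathbf D\alpha|t|$; it is weakened here to the
      -- $4\mathbf D\alpha|t|$ of the remainder.
      _ ≤ _ := by
          dsimp only
          gcongr
          norm_num

end Main

end FermiLattice

theorem mainTheorem3 {d : ℕ} (hd : 0 < d) (F : FermiLattice.DecayFunction d)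
    (Ψ : ℝ → FermiLattice.Interaction d) (V : ℝ → FermiLattice.Potential d)
    (hΨ_bdd : FermiLattice.supNormW Ψ F < ⊤)
    (hΨ_cont : ∀ Λ, Continuous fun t => (Ψ t).toFun Λ)
    (hV_cont : ∀ y, Continuous fun t => (V t).toFun y) :
    (∃ τ, FermiLattice.IsInfiniteVolumeDynamics Ψ V τ) ∧
    ∀ τ, FermiLattice.IsInfiniteVolumeDynamics Ψ V τ →
      ∀ (s : ℝ) (k : ℕ), 1 ≤ k →
      ∀ (m : ℕ → ℕ) (t : ℕ → ℝ) (x : ℕ → FermiLattice.Lattice d) (B : ℕ → FermiLattice.CAR d),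
        (∀ j ≤ k, B j ∈ FermiLattice.localAlg (FermiLattice.box (m j))) →
        (∀ j, 1 ≤ j → j ≤ k → FermiLattice.IsEven (B j)) →
        ‖FermiLattice.multiComm
            (fun j => if j = 0 then FermiLattice.translation (x 0) (B 0)
              else τ (t j) s (FermiLattice.translation (x j) (B j))) k‖ ≤
          2 ^ k * (∏ j ∈ Finset.range (k + 1), ‖B j‖) *
            ∑ T ∈ FermiLattice.trees k, (FermiLattice.kappa k T m x +
              FermiLattice.remainder F k T (FermiLattice.supNormW Ψ F).toReal
                (fun j => t j - s) m x) := by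
  open FermiLattice in
  refine ⟨exists_isInfiniteVolumeDynamics hΨ_bdd hΨ_cont hV_cont,
    fun τ hτ s k _ m t x B hB hBe => ?_⟩
  choose U hU hUm using exists_isHamPropagator hΨ_cont hV_cont (d := d)
  have hα0 : 0 ≤ (supNormW Ψ F).toReal := ENNReal.toReal_nonneg
  set c : ℕ → ℝ := fun j => 2 * (supNormW Ψ F).toReal * (|t j - s| *
    Real.exp (4 * F.D * (supNormW Ψ F).toReal * |t j - s|)) with hc
  have hc0 : ∀ j, 0 ≤ c j := fun j => by positivity
  have hBx : ∀ j, 1 ≤ j → j ≤ k → translation (x j) (B j) ∈ evenAlg (boxAt (m j) (x j)) :=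
    fun j h1 h2 => translation_mem_evenAlg (x j) (hB j h2) (hBe j h1 h2)
  set β : ℕ → ℕ → CAR d := fun j n => if j = 0 then translation (x 0) (B 0) else
    shellTerm U (t j) s (x j) (translation (x j) (B j)) (m j) n with hβ
  have hβj : ∀ j, 1 ≤ j → β j = shellTerm U (t j) s (x j) (translation (x j) (B j)) (m j) :=
    fun j hj => funext fun n => if_neg (by omega)
  -- The partial sums telescope to the dynamics of the box of size `N` about `x j`, so a bound
  -- uniform in `N` for the truncated expansion passes to the limit.
  have hlim : Filter.Tendsto (fun N : ℕ => multiComm (fun j => if j = 0 then β 0 (m 0) else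
      ∑ n ∈ Finset.Icc (m j) N, β j n) k) Filter.atTop (nhds (multiComm (fun j =>
        if j = 0 then translation (x 0) (B 0) else τ (t j) s (translation (x j) (B j))) k)) := by
    refine tendsto_multiComm fun j _ => ?_
    rcases Nat.eq_zero_or_pos j with rfl | hj
    · simp [hβ]
    · simp only [if_neg hj.ne']
      refine ((hτ.tendsto_conj hΨ_bdd hΨ_cont hV_cont hU hUm (translation (x j) (B j)) (t j) s).comp
        (tendsto_boxAt (x j))).congr' ?_
      filter_upwards [Filter.eventually_ge_atTop (m j)] with N hN
      rw [hβj j hj, sum_shellTerm U _ _ _ _ hN]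
      rfl
  refine le_of_tendsto' hlim.norm fun N => ?_
  rw [multiComm_sum]
  have hterm : ∀ ν ∈ multiIndices m (fun j => Finset.Icc (m j) N) k,
      ‖multiComm (fun j => β j (ν j)) k‖ ≤ 2 ^ k * (∏ j ∈ Finset.range (k + 1), ‖B j‖) *
        ∑ T ∈ trees k, kappa k T ν x * ∏ j ∈ Finset.Icc 1 k, shellWeight F c m j (ν j) := by
    intro ν hν
    obtain ⟨h1, h2⟩ := mem_multiIndices hν
    have hle : ∀ j, 1 ≤ j → j ≤ k → m j ≤ ν j := fun j hj hjk =>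
      (Finset.mem_Icc.1 (h1 j hj hjk)).1
    have hprod : ∏ j ∈ Finset.range (k + 1), ‖β j (ν j)‖ ≤
        (∏ j ∈ Finset.range (k + 1), ‖B j‖) *
          ∏ j ∈ Finset.Icc 1 k, shellWeight F c m j (ν j) := by
      have hr : Finset.range (k + 1) = insert 0 (Finset.Icc 1 k) := by
        ext j
        simp only [Finset.mem_range, Finset.mem_insert, Finset.mem_Icc]
        omega
      rw [hr, Finset.prod_insert (by simp), Finset.prod_insert (by simp), mul_assoc,
        ← Finset.prod_mul_distrib]
      have h0 : ‖β 0 (ν 0)‖ = ‖B 0‖ := by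
        simp only [hβ, if_true]
        exact norm_translation _ _
      rw [h0]
      refine mul_le_mul_of_nonneg_left (Finset.prod_le_prod (fun _ _ => norm_nonneg _)
        fun j hj => ?_) (norm_nonneg _)
      rw [Finset.mem_Icc] at hj
      rw [hβj j hj.1, ← norm_translation (x j) (B j)]
      exact norm_shellTerm_le hΨ_bdd hΨ_cont hV_cont hU hUm t s m j
        (evenAlg_le_clAlg _ (hBx j hj.1 hj.2)) (hle j hj.1 hj.2)
    refine (norm_multiComm_le_sum_kappa (n := ν) (x := x) ?_ fun j hj hjk => ?_).trans ?_
    · rw [h2 0 (Or.inl rfl)]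
      simp only [hβ, if_true]
      exact localAlg_le_clAlg _ (translation_mem_localAlg (x 0) (hB 0 (Nat.zero_le k)))
    · rw [hβj j hj]
      exact shellTerm_mem_evenAlg hUm _ _ (hBx j hj hjk) (hle j hj hjk)
    · rw [← Finset.sum_mul]
      have hκ : 0 ≤ ∑ T ∈ trees k, kappa k T ν x :=
        Finset.sum_nonneg fun T _ => kappa_nonneg k T ν x
      calc _ ≤ 2 ^ k * ((∏ j ∈ Finset.range (k + 1), ‖B j‖) *
            ∏ j ∈ Finset.Icc 1 k, shellWeight F c m j (ν j)) *
              ∑ T ∈ trees k, kappa k T ν x := by gcongr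
        _ = _ := by ring
  refine (norm_sum_le _ _).trans ((Finset.sum_le_sum hterm).trans ?_)
  -- After exchanging the sums, each tree is treated separately, with a bound independent of the
  -- cutoff `N`.
  rw [← Finset.mul_sum, Finset.sum_comm]
  refine mul_le_mul_of_nonneg_left (Finset.sum_le_sum fun T _ => ?_) (by positivity)
  exact sum_multiIndices_le_kappa_add_remainder F k T hα0 (fun j => t j - s) m x N
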